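/- Let $E=(E^0,E^1,s,r)$ be a finite directed graph with no sinks and no sources (every vertex is the source of some edge and the range of some edge). For $k\ge 0$ let $E^k$ be the set of paths $\alpha=e_1\cdots e_k$ of length $|\alpha|=k$ ($e_i\in E^1$, $s(e_j)=r(e_{j+1})$), with $r(\alpha)=r(e_1)$ and $s(\alpha)=s(e_k)$; paths of length $0$ are vertices. Let $A=c(E^0)$ be the $C^*$-algebra of functions on $E^0$, and let $X_{E^k}=c(E^k)$ be the $A$-correspondence with $(a\cdot\xi)(\alpha)=a(r(\alpha))\xi(\alpha)$, $(\xi\cdot a)(\alpha)=\xi(\alpha)a(s(\alpha))$ and $\langle\xi,\eta\rangle(v)=\sum_{s(\alpha)=v}\overline{\xi(\alpha)}\eta(\alpha)$; it is identified with $X_E^{\otimes k}$, where $X_E=X_{E^1}$ and $X_E^{\otimes 0}=A$. Let $\mathcal F=\bigoplus_{k\ge0}X_E^{\otimes k}$ be the Fock correspondence, $\mathcal L(\mathcal F)$ the $C^*$-algebra of its adjointable operators, $\mathcal K\subseteq\mathcal L(\mathcal F)$ the ideal of compact operators (the closed span of the maps $\theta_{\xi,\eta}:\zeta\mapsto\xi\langle\eta,\zeta\rangle$),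 and $q:\mathcal L(\mathcal F)\to\mathcal L(\mathcal F)/\mathcal K$ the quotient map. For $e\in E^1$ let $S_e\delta_\beta=\delta_{e\beta}$ if $r(\beta)=s(e)$ and $S_e\delta_\beta=0$ otherwise; for $v\in E^0$ let $P_v\delta_\beta=\delta_\beta$ if $r(\beta)=v$ and $P_v\delta_\beta=0$ otherwise. Put $u_e=q(S_e)$, $u_\alpha=u_{e_1}\cdots u_{e_k}$ for a path $\alpha=e_1\cdots e_k$ with $k\ge1$, and $u_v=q(P_v)$ for a vertex $v$. Let $Z=\{Z_k\}_{k\ge0}$ be a weight sequence: each $Z_k$ is a positive invertible adjointable operator on $X_E^{\otimes k}$ that commutes with the left action of $A$, $Z_0=I$, $\sup_k\|Z_k\|<\infty$, and there is $\varepsilon>0$ with $Z_k\ge\varepsilon I$ for all $k\ge1$. Put $z=q(\mathrm{diag}(Z_0,Z_1,\dots))$. Let $p\ge1$ and assume that $\lim_{k\to\infty}\|I_p\otimes Z_k-Z_{k+p}\|=0$, where $(I_p\otimes Z_k)\delta_{\beta\gamma}=\delta_\beta\otimes Z_k\delta_\gamma$ for $|\beta|=p$, $|\gamma|=k$. For $n\ge0$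 let $$\mathcal C_n=C^*\bigl(\{u_\alpha z^lu_\beta^*:\ l\ge0,\ np\le|\alpha|=|\beta|<(n+1)p,\ s(\alpha)=s(\beta)\}\bigr)\subseteq\mathcal L(\mathcal F)/\mathcal K .$$ For every $v\in E^0$ fix a path $\xi_v$ of length $p-1$ with $s(\xi_v)=v$, and let $\mathcal C_v=u_{\xi_v}u_{\xi_v}^*\,\mathcal C_0\,u_{\xi_v}u_{\xi_v}^*$. For $c\in\mathcal C_n$ let $$\tau_n(c)=\sum_{|\gamma_1|=|\gamma_2|=np+p-1,\ s(\gamma_1)=s(\gamma_2)}e_{\gamma_1,\gamma_2}\otimes u_{\xi_{s(\gamma_1)}}u_{\gamma_1}^*\,c\,u_{\gamma_2}u_{\xi_{s(\gamma_2)}}^* ,$$ where the $e_{\gamma_1,\gamma_2}$ are the matrix units indexed by $E^{np+p-1}$. For $e,f\in E^1$ with $r(e)=r(f)$ and $s(e)=s(f)$ let, for $c\in\mathcal C_{r(e)}$, $$\pi(e,f)(c)=u_{\xi_{s(e)}}u_e^*u_{\xi_{r(e)}}^*\,c\,u_{\xi_{r(f)}}u_fu_{\xi_{s(f)}}^* .$$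 Let $n\ge0$ and let $J$ be a two-sided ideal of $\mathcal C_n$ (not necessarily closed). Then there is a unique family $\{J_v\}_{v\in E^0}$ of subspaces (the corner ideals of $J$) such that 1. each $J_v$ is a two-sided ideal of $\mathcal C_v$; 2. $\tau_n(J)=\sum_{|\mu_1|=|\mu_2|=np+p-1,\ s(\mu_1)=s(\mu_2)}e_{\mu_1,\mu_2}\otimes J_{s(\mu_1)}$; 3. $J_v=u_{\xi_v}u_{\mu_1}^*\,J\,u_{\mu_2}u_{\xi_v}^*$ whenever $|\mu_1|=|\mu_2|=np+p-1$ and $s(\mu_1)=s(\mu_2)=v$; and $J$ is invariant, that is, $u_e^*Ju_f\subseteq J$ for all $e,f\in E^1$, if and only if $$\pi(e,f)(J_{r(e)})\subseteq J_{s(e)}\qquad\text{for all }e,f\in E^1\text{ with }r(e)=r(f)\text{ and }s(e)=s(f).$$ -/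

import Mathlib

open scoped ENNReal Topology

noncomputable section

namespace WeightedCK

/-- A directed graph with vertex set `V`, edge set `E`, source map `s` and range map `r`. -/
structure DirGraph (V E : Type*) where
  s : E → V
  r : E → V

namespace DirGraph

variable {V E : Type*} (G : DirGraph V E)

/-- No vertex is a sink: every vertex is the source of some edge. -/
def NoSinks : Prop := ∀ v, ∃ e, G.s e = v

/-- No vertex is a source: every vertex is the range of some edge. -/
def NoSources : Prop := ∀ v, ∃ e, G.r e = v

/-- `G.IsPath v [e₁, …, eₖ]` says that `r(e₁) = v` and `s(eⱼ) = r(eⱼ₊₁)` for `1 ≤ j < k`. -/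
def IsPath : V → List E → Prop
  | _, [] => True
  | v, e :: l => G.r e = v ∧ IsPath (G.s e) l

/-- The source of the path with range `v` and edges `l`: `s(eₖ)`, or `v` if there is no edge. -/
def endpoint : V → List E → V
  | v, [] => v
  | _, e :: l => endpoint (G.s e) l

theorem IsPath.take {v : V} {l : List E} (h : G.IsPath v l) (p : ℕ) : G.IsPath v (l.take p) := by
  induction l generalizing v p with
  | nil => simp [IsPath]
  | cons e l ih =>
    cases p with
    | zero => simp [IsPath]
    | succ p => exact ⟨h.1, ih h.2 p⟩

theorem IsPath.drop {v : V} {l : List E} (h : G.IsPath v l) (p : ℕ) :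
    G.IsPath (G.endpoint v (l.take p)) (l.drop p) := by
  induction l generalizing v p with
  | nil => simp [IsPath]
  | cons e l ih =>
    cases p with
    | zero => exact h
    | succ p => exact ih h.2 p

theorem IsPath.append {v : V} {l m : List E} (h : G.IsPath v l)
    (h' : G.IsPath (G.endpoint v l) m) : G.IsPath v (l ++ m) := by
  induction l generalizing v with
  | nil => exact h'
  | cons e l ih => exact ⟨h.1, ih h.2 h'⟩

/-- The set `E^k` of paths of length `k`, a path being given by its range and its list of edges
(so `E^0` is the set of vertices). -/
def Path (k : ℕ) : Type _ := {x : V × List E // G.IsPath x.1 x.2 ∧ x.2.length = k}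

namespace Path

variable {G} {k p : ℕ}

/-- The range `r(α)` of a path. -/
def rng (α : G.Path k) : V := α.1.1

/-- The list of edges of a path. -/
def edges (α : G.Path k) : List E := α.1.2

/-- The source `s(α)` of a path. -/
def src (α : G.Path k) : V := G.endpoint α.1.1 α.1.2

instance [Finite V] [Finite E] : Finite (G.Path k) := by
  have : Finite {l : List E // l.length = k} := (List.finite_length_eq E k).to_subtype
  refine Finite.of_injective
    (fun α : G.Path k => ((α.1.1, ⟨α.1.2, α.2.2⟩) : V × {l : List E // l.length = k})) ?_
  intro α β h
  simp only [Prod.mk.injEq, Subtype.mk.injEq] at h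
  exact Subtype.ext (Prod.ext h.1 h.2)

instance [Fintype V] [Fintype E] : Fintype (G.Path k) := Fintype.ofFinite _

/-- The first edge of a path of positive length. -/
def head (α : G.Path (k + 1)) : E :=
  α.1.2.head (List.ne_nil_of_length_pos (by rw [α.2.2]; exact k.succ_pos))

/-- The path `β` with `α = e β`, where `e` is the first edge of `α`. -/
def tail (α : G.Path (k + 1)) : G.Path k :=
  ⟨(G.s α.head, α.1.2.tail), by
    obtain ⟨⟨v, l⟩, h, hl⟩ := α
    cases l with
    | nil => simp at hl
    | cons e l => exact ⟨h.2, by simpa using hl⟩⟩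

/-- For `α = βγ` with `|β| = p` and `|γ| = k`, the path `β`. -/
def initial (α : G.Path (p + k)) : G.Path p :=
  ⟨(α.1.1, α.1.2.take p), IsPath.take G α.2.1 p, by simp [α.2.2]⟩

/-- For `α = βγ` with `|β| = p` and `|γ| = k`, the path `γ`. -/
def final (α : G.Path (p + k)) : G.Path k :=
  ⟨(G.endpoint α.1.1 (α.1.2.take p), α.1.2.drop p), IsPath.drop G α.2.1 p, by simp [α.2.2]⟩

/-- The path `βγ`, for `s(β) = r(γ)`. -/
def append (β : G.Path p) (γ : G.Path k) (h : β.src = γ.rng) : G.Path (p + k) :=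
  ⟨(β.1.1, β.1.2 ++ γ.1.2), IsPath.append G β.2.1 (by
    have h1 : G.endpoint β.1.1 β.1.2 = γ.1.1 := h
    rw [h1]; exact γ.2.1), by simp [β.2.2, γ.2.2]⟩

theorem src_tail (α : G.Path (k + 1)) : α.tail.src = α.src := by
  obtain ⟨⟨v, l⟩, h, hl⟩ := α
  cases l with
  | nil => simp at hl
  | cons e l => rfl

theorem head_tail_injective {α β : G.Path (k + 1)} (h : α.head = β.head)
    (h' : α.tail = β.tail) : α = β := by
  obtain ⟨⟨v, l⟩, h1, hl⟩ := α
  obtain ⟨⟨w, m⟩, h2, hm⟩ := β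
  cases l with
  | nil => simp at hl
  | cons e l =>
    cases m with
    | nil => simp at hm
    | cons f m =>
      have he : e = f := h
      have hlm : l = m := congrArg (fun x : G.Path k => x.1.2) h'
      subst he; subst hlm
      have : v = w := h1.1.symm.trans h2.1
      subst this; rfl

end Path

end DirGraph

variable {V E : Type*} [Fintype V] [Fintype E] (G : DirGraph V E)

/-! ### The correspondences `X_E^{⊗k}` and the Fock correspondence over `A = c(E^0) = (V → ℂ)`

`X_E^{⊗k}` is identified with `X_{E^k}`, the functions on `E^k`. Its `A`-valued inner product and
its right action only differ from a Hilbert space structure by being recorded source by source.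
Since `V` is finite, the norm of the Hilbert `A`-module (the maximum over `v ∈ E^0` of the `ℓ²`-norms
of the restrictions to `{α : s(α) = v}`) is equivalent to the `ℓ²`-norm, and the two operator norms
agree on adjointable operators, because these are the operators that preserve that decomposition. -/

/-- `X_E^{⊗k} = X_{E^k}`. -/
abbrev X (k : ℕ) : Type _ := EuclideanSpace ℂ (G.Path k)

/-- The Fock correspondence `⊕_{k ≥ 0} X_E^{⊗k}`. -/
abbrev Fock : Type _ := lp (fun k : ℕ => X G k) 2

open Classical in
/-- The `A`-valued inner product of `X_E^{⊗k}`: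
`⟨ξ, η⟩(v) = ∑_{s(α) = v} conj ξ(α) η(α)`. -/
def innerX {k : ℕ} (ξ η : X G k) : V → ℂ := fun v =>
  ∑ α : G.Path k, if α.src = v then star (ξ α) * η α else 0

/-- The `A`-valued inner product of the Fock correspondence. -/
def innerA (ξ η : Fock G) : V → ℂ := fun v => ∑' k, innerX G (ξ k) (η k) v

/-- The bounded operator `T` on `X_E^{⊗k}` is adjointable for the `A`-valued inner product.
(The adjoint, if there is one, is the Hilbert space adjoint: sum over `v`.) -/
def IsAdjointableX {k : ℕ} (T : X G k →L[ℂ] X G k) : Prop :=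
  ∀ ξ η, innerX G (T ξ) η = innerX G ξ (ContinuousLinearMap.adjoint T η)

/-- Pointwise multiplication by a function `g` on `E^k`. -/
def mulX {k : ℕ} (g : G.Path k → ℂ) : X G k →L[ℂ] X G k :=
  LinearMap.toContinuousLinearMap
    { toFun := fun ξ => WithLp.toLp 2 fun α => g α * ξ α
      map_add' := fun ξ η => by ext α; simp [mul_add]
      map_smul' := fun c ξ => by ext α; simp; ring }

/-- The left action of `a ∈ A` on `X_E^{⊗k}`: `(a·ξ)(α) = a(r(α)) ξ(α)`. -/
def leftX (k : ℕ) (a : V → ℂ) : X G k →L[ℂ] X G k := mulX G fun α => a α.rng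

/-- The right action of `a ∈ A` on `X_E^{⊗k}`: `(ξ·a)(α) = ξ(α) a(s(α))`. -/
def rightX (k : ℕ) (a : V → ℂ) : X G k →L[ℂ] X G k := mulX G fun α => a α.src

theorem mulX_apply {k : ℕ} (g : G.Path k → ℂ) (ξ : X G k) (α : G.Path k) :
    mulX G g ξ α = g α * ξ α := rfl

theorem norm_mulX_le {k : ℕ} {g : G.Path k → ℂ} {C : ℝ} (hC : 0 ≤ C) (hg : ∀ α, ‖g α‖ ≤ C) :
    ‖mulX G g‖ ≤ C := by
  refine ContinuousLinearMap.opNorm_le_bound _ hC fun ξ => ?_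
  rw [EuclideanSpace.norm_eq, EuclideanSpace.norm_eq]
  refine Real.sqrt_le_iff.2 ⟨by positivity, ?_⟩
  rw [mul_pow, Real.sq_sqrt (by positivity), Finset.mul_sum]
  refine Finset.sum_le_sum fun α _ => ?_
  rw [mulX_apply, norm_mul, mul_pow]
  gcongr
  exact hg α

/-- The operator `diag(T_0, T_1, …)` on the Fock correspondence, for a bounded sequence `T`. -/
def diag (T : ∀ k, X G k →L[ℂ] X G k) (hT : ∃ C, ∀ k, ‖T k‖ ≤ C) : Fock G →L[ℂ] Fock G :=
  have hC : ∀ k, ‖T k‖ ≤ max hT.choose 0 := fun k => (hT.choose_spec k).trans (le_max_left _ _)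
  have hb : ∀ (ξ : Fock G) k, ‖T k (ξ k)‖ ≤ ‖(((max hT.choose 0 : ℝ) : ℂ) • ξ : Fock G) k‖ :=
    fun ξ k => by
      rw [lp.coeFn_smul, Pi.smul_apply, norm_smul, Complex.norm_real, Real.norm_of_nonneg
        (le_max_right _ _)]
      exact (T k).le_of_opNorm_le (hC k) _
  LinearMap.mkContinuous
    { toFun := fun ξ => ⟨fun k => T k (ξ k), (lp.memℓp _).mono' (hb ξ)⟩
      map_add' := fun ξ η => by
        apply lp.ext; funext k
        exact map_add (T k) (ξ k) (η k)
      map_smul' := fun c ξ => by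
        apply lp.ext; funext k
        exact map_smul (T k) c (ξ k) }
    (max hT.choose 0) fun ξ => by
      refine (lp.norm_mono (by norm_num) (hb ξ)).trans ?_
      rw [norm_smul, Complex.norm_real, Real.norm_of_nonneg (le_max_right _ _)]

theorem diag_apply (T : ∀ k, X G k →L[ℂ] X G k) (hT : ∃ C, ∀ k, ‖T k‖ ≤ C) (ξ : Fock G) (k : ℕ) :
    diag G T hT ξ k = T k (ξ k) := rfl

theorem actions_bounded {f : ∀ k, G.Path k → V} (a : V → ℂ) :
    ∃ C, ∀ k, ‖mulX G (fun α : G.Path k => a (f k α))‖ ≤ C :=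
  ⟨‖a‖, fun _ => norm_mulX_le G (norm_nonneg _) fun _ => norm_le_pi_norm a _⟩

/-- The left action `φ_∞(a)` of `a ∈ A` on the Fock correspondence. -/
def leftFock (a : V → ℂ) : Fock G →L[ℂ] Fock G :=
  diag G (fun k => leftX G k a) (actions_bounded G (f := fun _ α => α.rng) a)

/-- The right action `ξ ↦ ξ·a` of `a ∈ A` on the Fock correspondence. -/
def rightFock (a : V → ℂ) : Fock G →L[ℂ] Fock G :=
  diag G (fun k => rightX G k a) (actions_bounded G (f := fun _ α => α.src) a)

open Classical in
theorem innerX_eq {k : ℕ} (ξ η : X G k) (v : V) :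
    innerX G ξ η v = inner ℂ ξ (rightX G k (Pi.single v 1) η) := by
  rw [PiLp.inner_apply, innerX]
  refine Finset.sum_congr rfl fun α _ => ?_
  rw [rightX, mulX_apply]
  by_cases h : α.src = v
  · subst h; simp [mul_comm]
  · simp [h]

open Classical in
theorem innerA_eq (ξ η : Fock G) (v : V) :
    innerA G ξ η v = inner ℂ ξ (rightFock G (Pi.single v 1) η) := by
  rw [lp.inner_eq_tsum, innerA]
  exact tsum_congr fun k => innerX_eq G _ _ _

/-! ### The `C^*`-algebra `𝓛(𝓕(X_E))` of adjointable operators -/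

theorem innerA_add_left (ξ ξ' η : Fock G) :
    innerA G (ξ + ξ') η = innerA G ξ η + innerA G ξ' η := by
  funext v; simp only [innerA_eq, inner_add_left, Pi.add_apply]

theorem innerA_add_right (ξ η η' : Fock G) :
    innerA G ξ (η + η') = innerA G ξ η + innerA G ξ η' := by
  funext v; simp only [innerA_eq, inner_add_right, Pi.add_apply, map_add]

theorem innerA_smul_right (c : ℂ) (ξ η : Fock G) :
    innerA G ξ (c • η) = c • innerA G ξ η := by
  funext v; simp only [innerA_eq, inner_smul_right, Pi.smul_apply, map_smul, smul_eq_mul]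

theorem innerA_smul_left (c : ℂ) (ξ η : Fock G) :
    innerA G (c • ξ) η = star c • innerA G ξ η := by
  funext v; simp only [innerA_eq, inner_smul_left, Pi.smul_apply, smul_eq_mul]; rfl

theorem innerX_star {k : ℕ} (ξ η : X G k) (v : V) :
    star (innerX G ξ η v) = innerX G η ξ v := by
  simp only [innerX, star_sum]
  refine Finset.sum_congr rfl fun α _ => ?_
  split_ifs <;> simp [mul_comm]

theorem innerA_star (ξ η : Fock G) : star (innerA G ξ η) = innerA G η ξ := by
  funext v
  simp only [innerA, Pi.star_apply]
  rw [tsum_star]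
  exact tsum_congr fun k => innerX_star G _ _ _

/-- The algebra `𝓛(𝓕(X_E))` of operators on the Fock correspondence that are adjointable for
its `A`-valued inner product. -/
def L : StarSubalgebra ℂ (Fock G →L[ℂ] Fock G) where
  carrier := {T | ∀ ξ η, innerA G (T ξ) η = innerA G ξ (ContinuousLinearMap.adjoint T η)}
  mul_mem' := by
    intro S T hS hT ξ η
    rw [← ContinuousLinearMap.star_eq_adjoint, star_mul]
    exact (hS _ _).trans (hT _ _)
  add_mem' := by
    intro S T hS hT ξ η
    rw [map_add]
    change innerA G (S ξ + T ξ) η = innerA G ξ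
      (ContinuousLinearMap.adjoint S η + ContinuousLinearMap.adjoint T η)
    rw [innerA_add_left, innerA_add_right, hS, hT]
  algebraMap_mem' := by
    intro c ξ η
    rw [← ContinuousLinearMap.star_eq_adjoint, ← algebraMap_star_comm]
    simp only [Algebra.algebraMap_eq_smul_one]
    change innerA G (c • ξ) η = innerA G ξ (star c • η)
    rw [innerA_smul_left, innerA_smul_right]
  star_mem' := by
    intro T hT ξ η
    rw [ContinuousLinearMap.star_eq_adjoint, ContinuousLinearMap.adjoint_adjoint]
    rw [← innerA_star, ← hT, innerA_star]

theorem rightFock_apply (a : V → ℂ) (ξ : Fock G) (k : ℕ) (α : G.Path k) :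
    rightFock G a ξ k α = a α.src * ξ k α := rfl

theorem inner_rightX (k : ℕ) (a : V → ℂ) (ξ η : X G k) :
    inner ℂ (rightX G k a ξ) η = inner ℂ ξ (rightX G k (star a) η) := by
  rw [PiLp.inner_apply, PiLp.inner_apply]
  refine Finset.sum_congr rfl fun α _ => ?_
  simp [rightX, mulX_apply]; ring

theorem inner_rightFock (a : V → ℂ) (ξ η : Fock G) :
    inner ℂ (rightFock G a ξ) η = inner ℂ ξ (rightFock G (star a) η) := by
  rw [lp.inner_eq_tsum, lp.inner_eq_tsum]
  exact tsum_congr fun k => inner_rightX G k a _ _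

/-- Bounded operators that commute with the right action are adjointable. -/
theorem mem_L_of_commute {T : Fock G →L[ℂ] Fock G}
    (hT : ∀ a ξ, T (rightFock G a ξ) = rightFock G a (T ξ)) : T ∈ L G := by
  classical
  intro ξ η
  funext v
  rw [innerA_eq, innerA_eq]
  have h : ContinuousLinearMap.adjoint T (rightFock G (Pi.single v 1) η) =
      rightFock G (Pi.single v 1) (ContinuousLinearMap.adjoint T η) := by
    refine ext_inner_left ℂ fun ζ => ?_
    have hs : star (Pi.single v 1 : V → ℂ) = Pi.single v 1 := by
      rw [← Pi.single_star, star_one]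
    rw [ContinuousLinearMap.adjoint_inner_right, ← hs, ← inner_rightFock, ← hT, ← inner_rightFock,
      ContinuousLinearMap.adjoint_inner_right]
  rw [← h, ContinuousLinearMap.adjoint_inner_right]

theorem sum_innerA (ξ η : Fock G) : ∑ v, innerA G ξ η v = inner ℂ ξ η := by
  classical
  simp only [innerA_eq, ← inner_sum]
  congr 1
  apply lp.ext; funext k
  rw [lp.coeFn_sum, Finset.sum_apply]
  ext α
  rw [WithLp.ofLp_sum, Finset.sum_apply]
  simp only [rightFock_apply]
  rw [Finset.sum_eq_single α.src]
  · simp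
  · intro v _ hv; simp [hv.symm]
  · simp

theorem innerA_rightFock (b : V → ℂ) (ζ η : Fock G) (v : V) :
    innerA G ζ (rightFock G b η) v = b v * innerA G ζ η v := by
  classical
  rw [innerA_eq, innerA_eq, ← inner_smul_right]
  congr 1
  apply lp.ext; funext k; ext α
  rw [lp.coeFn_smul]
  change _ = b v * (rightFock G (Pi.single v 1) η k α)
  rw [rightFock_apply, rightFock_apply, rightFock_apply]
  by_cases h : α.src = v
  · subst h; ring
  · simp [h]

/-- Adjointable operators are module maps. -/
theorem commute_of_mem_L {T : Fock G →L[ℂ] Fock G} (hT : T ∈ L G) (a : V → ℂ) (ξ : Fock G) :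
    T (rightFock G a ξ) = rightFock G a (T ξ) := by
  classical
  refine ext_inner_left ℂ fun η => ?_
  rw [← ContinuousLinearMap.adjoint_inner_left, ← sum_innerA, ← sum_innerA]
  refine Finset.sum_congr rfl fun v _ => ?_
  have h2 : star T ∈ L G := star_mem hT
  have h3 := congrFun (h2 η ξ) v
  rw [ContinuousLinearMap.star_eq_adjoint, ContinuousLinearMap.adjoint_adjoint] at h3
  rw [innerA_rightFock, innerA_rightFock, ← h3]

/-! ### Compact operators and the quotient `𝓛(𝓕(X_E)) / 𝓚` -/

/-- `T` is the operator `θ_{ξ,η} : ζ ↦ ξ·⟨η, ζ⟩` for some `ξ, η`. -/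
def IsTheta (T : L G) : Prop :=
  ∃ ξ η : Fock G, ∀ ζ : Fock G, T.1 ζ = rightFock G (innerA G η ζ) ξ

theorem IsTheta.mul_left {T : L G} (h : IsTheta G T) (S : L G) : IsTheta G (S * T) := by
  obtain ⟨ξ, η, h⟩ := h
  refine ⟨S.1 ξ, η, fun ζ => ?_⟩
  change S.1 (T.1 ζ) = _
  rw [h, commute_of_mem_L G S.2]

theorem IsTheta.mul_right {T : L G} (h : IsTheta G T) (S : L G) : IsTheta G (T * S) := by
  obtain ⟨ξ, η, h⟩ := h
  refine ⟨ξ, ContinuousLinearMap.adjoint S.1 η, fun ζ => ?_⟩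
  change T.1 (S.1 ζ) = _
  rw [h, ← innerA_star, S.2, innerA_star]

theorem IsTheta.star {T : L G} (h : IsTheta G T) : IsTheta G (star T) := by
  classical
  obtain ⟨ξ, η, h⟩ := h
  refine ⟨η, ξ, fun ζ => ?_⟩
  have key : ∀ (a : V → ℂ) (x y : Fock G),
      inner ℂ x (rightFock G a y) = ∑ v, a v * innerA G x y v := by
    intro a x y
    rw [← sum_innerA]
    exact Finset.sum_congr rfl fun v _ => innerA_rightFock G a x y v
  refine ext_inner_left ℂ fun x => ?_
  change inner ℂ x (ContinuousLinearMap.adjoint T.1 ζ) = _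
  rw [ContinuousLinearMap.adjoint_inner_right, h, inner_rightFock, key, key]
  refine Finset.sum_congr rfl fun v _ => ?_
  rw [innerA_star, mul_comm]

/-- The linear span of the operators `θ_{ξ,η}`. -/
def thetaSpan : Submodule ℂ (L G) := Submodule.span ℂ {T | IsTheta G T}

/-- The ideal `𝓚 = 𝓚(𝓕(X_E))` of (generalized) compact operators: the closed linear span of
the operators `θ_{ξ,η}`. -/
def K : Ideal (L G) where
  carrier := closure (thetaSpan G : Set (L G))
  add_mem' := fun ha hb => (thetaSpan G).toAddSubmonoid.topologicalClosure.add_mem ha hb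
  zero_mem' := subset_closure (thetaSpan G).zero_mem
  smul_mem' := by
    intro S T hT
    refine map_mem_closure (f := fun T => S * T) (continuous_const.mul continuous_id) hT ?_
    intro T hT
    refine Submodule.span_induction ?_ ?_ ?_ ?_ hT
    · exact fun T hT => Submodule.subset_span (IsTheta.mul_left G hT S)
    · simp
    · intro x y _ _ hx hy
      simpa [mul_add] using (thetaSpan G).add_mem hx hy
    · intro c x _ hx
      simpa [mul_smul_comm] using (thetaSpan G).smul_mem c hx

instance : (K G).IsTwoSided where
  mul_mem_of_left := by
    intro T S hT
    refine map_mem_closure (f := fun T => T * S) (continuous_id.mul continuous_const) hT ?_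
    intro T hT
    refine Submodule.span_induction ?_ ?_ ?_ ?_ hT
    · exact fun T hT => Submodule.subset_span (IsTheta.mul_right G hT S)
    · simp
    · intro x y _ _ hx hy
      simpa [add_mul] using (thetaSpan G).add_mem hx hy
    · intro c x _ hx
      simpa [smul_mul_assoc] using (thetaSpan G).smul_mem c hx

theorem star_mem_K {T : L G} (hT : T ∈ K G) : star T ∈ K G := by
  refine map_mem_closure (f := fun T : L G => star T) continuous_star hT ?_
  intro T hT
  refine Submodule.span_induction ?_ ?_ ?_ ?_ hT
  · exact fun T hT => Submodule.subset_span (IsTheta.star G hT)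
  · simp
  · intro x y _ _ hx hy
    simpa using (thetaSpan G).add_mem hx hy
  · intro c x _ hx
    simpa using (thetaSpan G).smul_mem (star c) hx

/-- The quotient algebra `𝓛(𝓕(X_E)) / 𝓚`, with the quotient norm. -/
def LK : Type _ := L G ⧸ K G

instance : Ring (LK G) := inferInstanceAs (Ring (L G ⧸ K G))

instance : Algebra ℂ (LK G) := inferInstanceAs (Algebra ℂ (L G ⧸ K G))

/-- The topology of the quotient norm. -/
instance : TopologicalSpace (LK G) :=
  (Submodule.Quotient.seminormedAddCommGroup (K G)).toUniformSpace.toTopologicalSpace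

/-- The quotient map `q`. -/
def q : L G →+* LK G := Ideal.Quotient.mk (K G)

instance : Star (LK G) where
  star := Quotient.lift (fun T => q G (star T)) fun S T h => by
    have h' : S - T ∈ K G := (Submodule.quotientRel_def _).1 h
    refine Ideal.Quotient.eq.2 ?_
    rw [← star_sub]
    exact star_mem_K G h'

theorem star_q (T : L G) : star (q G T) = q G (star T) := rfl

theorem q_surjective : Function.Surjective (q G) := Ideal.Quotient.mk_surjective

instance : StarRing (LK G) where
  star_involutive := fun x => by
    obtain ⟨T, rfl⟩ := q_surjective G x
    rw [star_q, star_q, star_star]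
  star_mul := fun x y => by
    obtain ⟨S, rfl⟩ := q_surjective G x
    obtain ⟨T, rfl⟩ := q_surjective G y
    rw [← map_mul, star_q, star_q, star_q, star_mul, map_mul]
  star_add := fun x y => by
    obtain ⟨S, rfl⟩ := q_surjective G x
    obtain ⟨T, rfl⟩ := q_surjective G y
    rw [← map_add, star_q, star_q, star_q, star_add, map_add]

theorem q_smul (c : ℂ) (T : L G) : q G (c • T) = c • q G T := rfl

instance : StarModule ℂ (LK G) where
  star_smul := fun c x => by
    obtain ⟨T, rfl⟩ := q_surjective G x
    rw [← q_smul, star_q, star_q, star_smul, q_smul]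

/-- The `C^*`-subalgebra `C^*(M)` of `𝓛(𝓕(X_E)) / 𝓚` generated by a subset `M`: the smallest
norm closed `*`-subalgebra that contains `M`. -/
def generatedCStar (M : Set (LK G)) : NonUnitalStarSubalgebra ℂ (LK G) :=
  sInf {S | IsClosed (S : Set (LK G)) ∧ M ⊆ S}

/-! ### Creation operators, weights, and their images in the quotient -/

open Classical in
/-- The map `δ_e ⊗ · : X_E^{⊗k} → X_E^{⊗(k+1)}`, sending `δ_β` to `δ_{eβ}` if `r(β) = s(e)` and
to `0` otherwise. -/
def createX (e : E) (k : ℕ) : X G k →ₗ[ℂ] X G (k + 1) where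
  toFun ξ := WithLp.toLp 2 fun α => if α.head = e then ξ α.tail else 0
  map_add' ξ η := by ext α; by_cases h : α.head = e <;> simp [h]
  map_smul' c ξ := by ext α; by_cases h : α.head = e <;> simp [h]

theorem norm_createX_le (e : E) (k : ℕ) (ξ : X G k) : ‖createX G e k ξ‖ ≤ ‖ξ‖ := by
  classical
  rw [EuclideanSpace.norm_eq, EuclideanSpace.norm_eq]
  refine Real.sqrt_le_sqrt ?_
  have h1 : ∀ α : G.Path (k + 1), ‖createX G e k ξ α‖ ^ 2 =
      if α.head = e then ‖ξ α.tail‖ ^ 2 else 0 := by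
    intro α
    change ‖if α.head = e then ξ α.tail else 0‖ ^ 2 = _
    split_ifs <;> simp
  simp only [h1]
  rw [← Finset.sum_filter]
  rw [← Finset.sum_image (s := Finset.univ.filter fun α : G.Path (k + 1) => α.head = e)
    (g := DirGraph.Path.tail) (f := fun β => ‖ξ β‖ ^ 2)]
  · exact Finset.sum_le_univ_sum_of_nonneg fun β => by positivity
  · intro α hα β hβ h
    simp only [Finset.coe_filter, Finset.mem_univ, true_and, Set.mem_ofPred_eq] at hα hβ
    exact DirGraph.Path.head_tail_injective (hα.trans hβ.symm) h

/-- The sequence of components of `δ_e ⊗ ξ`. -/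
def createSeq (e : E) (ξ : Fock G) : ∀ k, X G k
  | 0 => 0
  | k + 1 => createX G e k (ξ k)

theorem createSeq_summable (e : E) (ξ : Fock G) :
    Summable (fun k => ‖createSeq G e ξ k‖ ^ (2 : ℝ≥0∞).toReal) ∧
    ∑' k, ‖createSeq G e ξ k‖ ^ (2 : ℝ≥0∞).toReal ≤ ‖ξ‖ ^ (2 : ℝ≥0∞).toReal := by
  have hp : 0 < (2 : ℝ≥0∞).toReal := by norm_num
  have hle : ∀ k, ‖createSeq G e ξ (k + 1)‖ ^ (2 : ℝ≥0∞).toReal ≤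
      ‖ξ k‖ ^ (2 : ℝ≥0∞).toReal := fun k =>
    Real.rpow_le_rpow (norm_nonneg _) (norm_createX_le G e k (ξ k)) hp.le
  have hs := lp.hasSum_norm hp ξ
  have h1 : Summable fun k => ‖createSeq G e ξ (k + 1)‖ ^ (2 : ℝ≥0∞).toReal :=
    Summable.of_nonneg_of_le (fun k => by positivity) hle hs.summable
  have h2 := (summable_nat_add_iff
    (f := fun k => ‖createSeq G e ξ k‖ ^ (2 : ℝ≥0∞).toReal) 1).1 h1
  refine ⟨h2, ?_⟩
  rw [h2.tsum_eq_zero_add]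
  have h0 : ‖createSeq G e ξ 0‖ ^ (2 : ℝ≥0∞).toReal = 0 := by
    simp [createSeq]
  rw [h0, zero_add, ← hs.tsum_eq]
  exact h1.tsum_le_tsum hle hs.summable

/-- The creation operator `S_e` as a bounded operator: `S_e ξ = δ_e ⊗ ξ`. -/
def createFock (e : E) : Fock G →L[ℂ] Fock G :=
  LinearMap.mkContinuous
    { toFun := fun ξ => ⟨createSeq G e ξ, memℓp_gen (createSeq_summable G e ξ).1⟩
      map_add' := fun ξ η => by
        apply lp.ext; funext k
        cases k with
        | zero => exact (add_zero (0 : X G 0)).symm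
        | succ k => exact map_add (createX G e k) (ξ k) (η k)
      map_smul' := fun c ξ => by
        apply lp.ext; funext k
        cases k with
        | zero => exact (smul_zero c : c • (0 : X G 0) = 0).symm
        | succ k => exact map_smul (createX G e k) c (ξ k) }
    1 fun ξ => by
      rw [one_mul]
      exact lp.norm_le_of_tsum_le (by norm_num) (norm_nonneg _) (createSeq_summable G e ξ).2

open Classical in
/-- The creation operator `S_e ∈ 𝓛(𝓕(X_E))`. -/
def S (e : E) : L G := ⟨createFock G e, mem_L_of_commute G fun a ξ => by
  apply lp.ext; funext k
  cases k with
  | zero => exact (map_zero (rightX G 0 a)).symm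
  | succ k =>
    ext α
    change (if α.head = e then a α.tail.src * ξ k α.tail else 0) =
      a α.src * (if α.head = e then ξ k α.tail else 0)
    rw [DirGraph.Path.src_tail]
    split_ifs <;> simp⟩

open Classical in
/-- The projection `P_v = φ_∞(δ_v) ∈ 𝓛(𝓕(X_E))`. -/
def P (v : V) : L G := ⟨leftFock G (Pi.single v 1), mem_L_of_commute G fun a ξ => by
  apply lp.ext; funext k; ext α
  change _ * (_ * _) = _ * (_ * _)
  ring⟩

/-- A weight sequence: operators `Z_k ∈ 𝓛(X_E^{⊗k}) ∩ φ(A)'`, positive and invertible, with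
`Z_0 = I`, `sup ‖Z_k‖ < ∞` and `Z_k ≥ ε I` for all `k ≥ 1`, for some `ε > 0`. -/
structure WeightSequence where
  Z : ∀ k, X G k →L[ℂ] X G k
  adjointable : ∀ k, IsAdjointableX G (Z k)
  commute_left : ∀ k a, Z k * leftX G k a = leftX G k a * Z k
  zero : Z 0 = 1
  bounded : ∃ C, ∀ k, ‖Z k‖ ≤ C
  positive : ∀ k, (Z k).IsPositive
  invertible : ∀ k, IsUnit (Z k)
  bounded_below : ∃ ε : ℝ, 0 < ε ∧ ∀ k, 1 ≤ k → (Z k - (ε : ℂ) • 1).IsPositive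

open Classical in
/-- For `β ∈ E^p`, the map `X_E^{⊗(p+k)} → X_E^{⊗k}`, `ξ ↦ (γ ↦ ξ(βγ))`, with value `0` at `γ`
when `βγ` is not a path. -/
def sliceX {p : ℕ} (k : ℕ) (β : G.Path p) : X G (p + k) →ₗ[ℂ] X G k where
  toFun ξ := WithLp.toLp 2 fun γ => if h : β.src = γ.rng then ξ (β.append γ h) else 0
  map_add' ξ η := by ext γ; by_cases h : β.src = γ.rng <;> simp [h]
  map_smul' c ξ := by ext γ; by_cases h : β.src = γ.rng <;> simp [h]

/-- The operator `I_p ⊗ T` on `X_E^{⊗(p+k)}`, for `T` in `𝓛(X_E^{⊗k}) ∩ φ(A)'`: it sends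
`δ_β ⊗ η` to `δ_β ⊗ T η`. In coordinates, `((I_p ⊗ T) ξ)(βγ) = (T (ξ(β ·)))(γ)`. -/
def idTensor (p : ℕ) {k : ℕ} (T : X G k →L[ℂ] X G k) : X G (p + k) →L[ℂ] X G (p + k) :=
  LinearMap.toContinuousLinearMap
    { toFun := fun ξ => WithLp.toLp 2 fun α => T (sliceX G k α.initial ξ) α.final
      map_add' := fun ξ η => by ext α; simp
      map_smul' := fun c ξ => by ext α; simp }

variable {G}

/-- Condition A(p): `‖I_p ⊗ Z_k - Z_{k+p}‖ → 0` as `k → ∞`. -/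
def ConditionA (W : WeightSequence G) (p : ℕ) : Prop :=
  Filter.Tendsto (fun k => ‖idTensor G p (W.Z k) - W.Z (p + k)‖) Filter.atTop (𝓝 0)

theorem commute_rightX {k : ℕ} {T : X G k →L[ℂ] X G k} (hT : IsAdjointableX G T) (a : V → ℂ)
    (ξ : X G k) : T (rightX G k a ξ) = rightX G k a (T ξ) := by
  classical
  have key : ∀ (b : V → ℂ) (ζ η : X G k),
      inner ℂ ζ (rightX G k b η) = ∑ v, b v * innerX G ζ η v := by
    intro b ζ η
    simp only [innerX_eq]
    rw [Finset.sum_congr rfl fun v _ => (inner_smul_right (𝕜 := ℂ) ζ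
      (rightX G k (Pi.single v 1) η) (b v)).symm, ← inner_sum]
    congr 1
    ext α
    rw [WithLp.ofLp_sum, Finset.sum_apply, Finset.sum_eq_single α.src]
    · simp [rightX, mulX_apply]
    · intro v _ hv; simp [rightX, mulX_apply, Pi.single_apply, hv.symm]
    · simp
  refine ext_inner_left ℂ fun η => ?_
  rw [← ContinuousLinearMap.adjoint_inner_left, key, key]
  refine Finset.sum_congr rfl fun v _ => ?_
  rw [← innerX_star, ← congrFun (hT ξ η) v, innerX_star]

/-- The weight operator `Z = diag(Z_0, Z_1, …) ∈ 𝓛(𝓕(X_E))`. -/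
def WeightSequence.op (W : WeightSequence G) : L G :=
  ⟨diag G W.Z W.bounded, mem_L_of_commute G fun a ξ => by
    apply lp.ext; funext k
    exact commute_rightX (W.adjointable k) a (ξ k)⟩

/-- `z = q(Z)`. -/
def WeightSequence.z (W : WeightSequence G) : LK G := q G W.op

variable (G) in
/-- `u_e = q(S_e)` for an edge `e`. -/
def u (e : E) : LK G := q G (S G e)

/-- `u_α = u_{e₁} ⋯ u_{eₖ}` for a path `α = e₁ ⋯ eₖ`; for a path of length `0`, that is, a vertex
`v`, it is `p_v = q(P_v)`. -/
def uPath {k : ℕ} (α : G.Path k) : LK G :=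
  match α.edges with
  | [] => q G (P G α.rng)
  | e :: l => ((e :: l).map (u G)).prod

/-- `C_n = C^*({u_α z^l u_β^* : l ≥ 0, np ≤ |α| = |β| < (n+1)p, s(α) = s(β)})`. -/
def C (W : WeightSequence G) (p n : ℕ) : NonUnitalStarSubalgebra ℂ (LK G) :=
  generatedCStar G {x | ∃ (l k : ℕ) (α β : G.Path k), n * p ≤ k ∧ k < (n + 1) * p ∧
    α.src = β.src ∧ x = uPath α * W.z ^ l * star (uPath β)}

/-- `C_v = u_{ξ_v} u_{ξ_v}^* C_0 u_{ξ_v} u_{ξ_v}^*`, for the chosen paths `ξ_v` of length `p - 1`. -/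
def Cv (W : WeightSequence G) (p : ℕ) (ξ : V → G.Path (p - 1)) (v : V) : Set (LK G) :=
  {x | ∃ c ∈ C W p 0,
    x = uPath (ξ v) * star (uPath (ξ v)) * c * (uPath (ξ v) * star (uPath (ξ v)))}

/-- The subspace `J` is a two-sided ideal of the algebra `B`. -/
def IsIdealOf (B : Set (LK G)) (J : Submodule ℂ (LK G)) : Prop :=
  (J : Set (LK G)) ⊆ B ∧ ∀ b ∈ B, ∀ x ∈ J, b * x ∈ J ∧ x * b ∈ J

/-- The subspace `J` is invariant: `u_e^* J u_f ⊆ J` for all edges `e, f`. -/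
def IsInvariant (J : Submodule ℂ (LK G)) : Prop :=
  ∀ e f : E, ∀ x ∈ J, star (u G e) * x * u G f ∈ J

open Classical in
/-- `τ_n(c) = ∑ e_{γ₁,γ₂} ⊗ u_{ξ_{s(γ₁)}} u_{γ₁}^* c u_{γ₂} u_{ξ_{s(γ₂)}}^*`, the sum being over the
paths `γ₁, γ₂` of length `np + p - 1` with `s(γ₁) = s(γ₂)`, as a matrix indexed by these paths. -/
def tau {p : ℕ} (ξ : V → G.Path (p - 1)) (n : ℕ) (c : LK G) :
    Matrix (G.Path (n * p + (p - 1))) (G.Path (n * p + (p - 1))) (LK G) :=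
  Matrix.of fun γ₁ γ₂ => if γ₁.src = γ₂.src then
    uPath (ξ γ₁.src) * star (uPath γ₁) * c * uPath γ₂ * star (uPath (ξ γ₂.src)) else 0

/-- `Jv` is the family of corner ideals of the ideal `J` of `C_n`: each `J_v` is an ideal
of `C_v`, `τ_n(J) = ∑_{s(μ₁) = s(μ₂)} e_{μ₁,μ₂} ⊗ J_{s(μ₁)}`, and
`J_v = u_{ξ_v} u_{μ₁}^* J u_{μ₂} u_{ξ_v}^*` whenever `|μ₁| = |μ₂| = np + p - 1` and
`s(μ₁) = s(μ₂) = v`. -/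
structure IsCornerFamily (W : WeightSequence G) (p n : ℕ) (ξ : V → G.Path (p - 1))
    (J : Submodule ℂ (LK G)) (Jv : V → Submodule ℂ (LK G)) : Prop where
  isIdeal : ∀ v, IsIdealOf (Cv W p ξ v) (Jv v)
  tau_image : tau ξ n '' (J : Set (LK G)) =
    {M | ∀ μ₁ μ₂, (μ₁.src = μ₂.src → M μ₁ μ₂ ∈ Jv μ₁.src) ∧ (μ₁.src ≠ μ₂.src → M μ₁ μ₂ = 0)}
  corner : ∀ (v : V) (μ₁ μ₂ : G.Path (n * p + (p - 1))), μ₁.src = v → μ₂.src = v →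
    (Jv v : Set (LK G)) =
      (fun x => uPath (ξ v) * star (uPath μ₁) * x * uPath μ₂ * star (uPath (ξ v))) ''
        (J : Set (LK G))

/-- `π(e,f)(c) = u_{ξ_{s(e)}} u_e^* u_{ξ_{r(e)}}^* c u_{ξ_{r(f)}} u_f u_{ξ_{s(f)}}^*`, for parallel
edges `e, f` and `c ∈ C_{r(e)}`. -/
def piMap {p : ℕ} (ξ : V → G.Path (p - 1)) (e f : E) (c : LK G) : LK G :=
  uPath (ξ (G.s e)) * star (u G e) * star (uPath (ξ (G.r e))) * c *
    uPath (ξ (G.r f)) * u G f * star (uPath (ξ (G.s f)))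

end WeightedCK

end

/-!
Modulo the compact operators the projection onto the vacuum level vanishes, so that the `u_e` and
the vertex projections satisfy the Cuntz–Krieger relations. The elements `e_{α,β} = u_α u_β^*` then
multiply as matrix units, also between paths of different lengths, and the hypothesis on `Z` says
that `z` commutes with `u_α` for `|α| = p`.

Compressing `u_α z^l u_β^*` by matrix units of the paths of length `np + p - 1` replaces its ends by
arbitrary paths with the same source. Hence an ideal `J` of `C_n` is determined by what it contains
between two fixed paths with source `v`, and transporting this part of `J` to `ξ_v` gives the corner
ideal `J_v`.

Since `z` commutes with the `u_α` for `|α| = p`, the elements `u_{ν₁}^* c u_{ν₂}` with `c` in `C_n`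
and `|ν₁| = |ν₂| = (n + 1)p` vanish unless `ν₁` and `ν₂` have the same last edge. Invariance of `J`
is therefore a condition on the passage from `μ` to `μ e` at both ends, for a single edge `e`, and
this passage is `π(e, e)` on the corner ideals.
-/

noncomputable section

namespace WeightedCK

/-! ### Composition of paths -/

namespace DirGraph

variable {V E : Type*} {G : DirGraph V E}

theorem endpoint_append (v : V) (l m : List E) :
    G.endpoint v (l ++ m) = G.endpoint (G.endpoint v l) m := by
  induction l generalizing v with
  | nil => rfl
  | cons e _ ih => exact ih (G.s e)

namespace Path

variable {j k : ℕ}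

theorem ext {α β : G.Path k} (hrng : α.rng = β.rng) (hedges : α.edges = β.edges) : α = β :=
  Subtype.ext (Prod.ext hrng hedges)

theorem isPath_edges (α : G.Path k) : G.IsPath α.rng α.edges := α.2.1

theorem length_edges (α : G.Path k) : α.edges.length = k := α.2.2

theorem src_append (α : G.Path j) (β : G.Path k) (h : α.src = β.rng) :
    (α.append β h).src = β.src :=
  (endpoint_append α.rng α.edges β.edges).trans (congrArg (fun v => G.endpoint v β.edges) h)

theorem initial_append (α : G.Path j) (β : G.Path k) (h : α.src = β.rng) :
    (α.append β h).initial = α :=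
  ext rfl (List.take_left' α.length_edges)

theorem final_append (α : G.Path j) (β : G.Path k) (h : α.src = β.rng) :
    (α.append β h).final = β :=
  ext ((congrArg src (initial_append α β h)).trans h) (List.drop_left' α.length_edges)

theorem append_initial_final (α : G.Path (j + k)) : α.initial.append α.final rfl = α :=
  ext rfl (List.take_append_drop j α.edges)

theorem src_final (α : G.Path (j + k)) : α.final.src = α.src := by
  rw [← src_append α.initial α.final rfl, append_initial_final]

variable (G) in
/-- A vertex, regarded as a path of length `0`. -/
def ofVertex (v : V) : G.Path 0 := ⟨(v, []), trivial, rfl⟩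

theorem edges_of_length_zero (α : G.Path 0) : α.edges = [] :=
  List.length_eq_zero_iff.1 α.length_edges

theorem eq_ofVertex (α : G.Path 0) : α = ofVertex G α.rng := ext rfl α.edges_of_length_zero

/-- The path `e β`, for `s(e) = r(β)`. -/
def cons (e : E) (β : G.Path k) (h : G.s e = β.rng) : G.Path (k + 1) :=
  ⟨(G.r e, e :: β.edges), ⟨rfl, h ▸ β.isPath_edges⟩, congrArg (· + 1) β.length_edges⟩

theorem tail_cons (e : E) (β : G.Path k) (h : G.s e = β.rng) : (cons e β h).tail = β :=
  ext h rfl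

theorem edges_eq_cons (α : G.Path (k + 1)) : α.edges = α.head :: α.tail.edges :=
  (List.cons_head_tail _).symm

theorem r_head (α : G.Path (k + 1)) : G.r α.head = α.rng := by
  have h := α.isPath_edges
  rw [edges_eq_cons] at h
  exact h.1

theorem exists_src_eq (hG : G.NoSinks) (k : ℕ) (v : V) : ∃ α : G.Path k, α.src = v := by
  induction k with
  | zero => exact ⟨ofVertex G v, rfl⟩
  | succ k ih =>
    obtain ⟨α, rfl⟩ := ih
    obtain ⟨e, he⟩ := hG α.rng
    exact ⟨cons e α he, by rw [← src_tail, tail_cons]⟩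

/-- The last edge of a path of positive length. -/
def last (α : G.Path (k + 1)) : E := α.final.head

theorem r_last (α : G.Path (k + 1)) : G.r α.last = (initial (k := 1) α).src := r_head α.final

theorem last_final (α : G.Path (j + (k + 1))) :
    α.final.last = last (k := j + k) α := by
  unfold last head final
  simp only [List.drop_drop]

/-- An edge, regarded as a path of length `1`. -/
def ofEdge (e : E) : G.Path 1 := ⟨(G.r e, [e]), ⟨rfl, trivial⟩, rfl⟩

/-- The path `μ e`, for `s(μ) = r(e)`; it is on these that `π(e, f)` acts. -/
def snoc (μ : G.Path k) (e : E) (h : μ.src = G.r e) : G.Path (k + 1) := μ.append (ofEdge e) h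

theorem src_snoc (μ : G.Path k) (e : E) (h : μ.src = G.r e) : (μ.snoc e h).src = G.s e :=
  src_append _ _ _

theorem last_snoc (μ : G.Path k) (e : E) (h : μ.src = G.r e) : (μ.snoc e h).last = e :=
  congrArg head (final_append _ _ _)

theorem exists_eq_snoc (α : G.Path (k + 1)) : ∃ μ e h, α = snoc μ e h := by
  refine ⟨initial (k := 1) α, α.last, α.r_last.symm, ?_⟩
  have hfinal : ofEdge α.last = α.final := by
    refine ext α.r_last ?_
    rw [edges_eq_cons α.final, edges_of_length_zero]
    rfl
  unfold snoc
  simp only [hfinal]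
  exact (append_initial_final α).symm

end Path

end DirGraph

variable {V E : Type*} [Fintype V] [Fintype E] {G : DirGraph V E}

/-! ### Coordinates of vectors in the Fock correspondence -/

open Classical in
variable (G) in
/-- The coordinate of a vector of the Fock correspondence at the path with range `v` and edges `l`,
which is `0` if there is no such path. Indexing paths of all lengths by their lists of edges avoids
casts between the spaces `X G k`. -/
def coord (v : V) (l : List E) : Fock G →ₗ[ℂ] ℂ :=
  if h : G.IsPath v l then
    { toFun := fun ξ => ξ l.length ⟨(v, l), h, rfl⟩
      map_add' := fun _ _ => rfl
      map_smul' := fun _ _ => rfl }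
  else 0

theorem coord_of_isPath {v : V} {l : List E} (h : G.IsPath v l) (ξ : Fock G) :
    coord G v l ξ = ξ l.length ⟨(v, l), h, rfl⟩ := by
  rw [coord, dif_pos h]
  rfl

theorem coord_of_not_isPath {v : V} {l : List E} (h : ¬ G.IsPath v l) (ξ : Fock G) :
    coord G v l ξ = 0 := by
  rw [coord, dif_neg h, LinearMap.zero_apply]

theorem apply_eq_coord (ξ : Fock G) {k : ℕ} (α : G.Path k) :
    ξ k α = coord G α.rng α.edges ξ := by
  obtain ⟨⟨v, l⟩, h, rfl⟩ := α
  exact (coord_of_isPath h ξ).symm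

theorem Fock.ext_coord {ξ η : Fock G}
    (h : ∀ v l, G.IsPath v l → coord G v l ξ = coord G v l η) : ξ = η := by
  apply lp.ext
  funext k
  ext α
  rw [apply_eq_coord, apply_eq_coord]
  exact h _ _ α.isPath_edges

theorem coord_S_nil (e : E) (v : V) (ξ : Fock G) : coord G v [] ((S G e).1 ξ) = 0 := by
  rw [coord_of_isPath (show G.IsPath v [] from trivial)]
  rfl

open Classical in
theorem coord_S_cons (e f : E) {v : V} {l : List E} (h : G.IsPath v (f :: l)) (ξ : Fock G) :
    coord G v (f :: l) ((S G e).1 ξ) = if f = e then coord G (G.s f) l ξ else 0 := by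
  rw [coord_of_isPath h, coord_of_isPath h.2]
  rfl

theorem leftX_apply {k : ℕ} (a : V → ℂ) (ξ : X G k) (α : G.Path k) :
    leftX G k a ξ α = a α.rng * ξ α := rfl

open Classical in
theorem coord_P (w v : V) (l : List E) (ξ : Fock G) :
    coord G v l ((P G w).1 ξ) = if v = w then coord G v l ξ else 0 := by
  by_cases h : G.IsPath v l
  · have hP : coord G v l ((P G w).1 ξ) = (Pi.single w 1 : V → ℂ) v * coord G v l ξ := by
      rw [coord_of_isPath h, coord_of_isPath h]
      rfl
    rw [hP, Pi.single_apply, ite_mul, one_mul, zero_mul]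
  · simp only [coord_of_not_isPath h, ite_self]

open Classical in
/-- The vector `δ_α` of the Fock correspondence; pairing with it reads off coordinates. -/
def deltaFock {k : ℕ} (α : G.Path k) : Fock G := lp.single 2 k (EuclideanSpace.single α 1)

theorem inner_deltaFock {k : ℕ} (α : G.Path k) (ξ : Fock G) :
    inner ℂ (deltaFock α) ξ = ξ k α := by
  classical
  rw [deltaFock, lp.inner_single_left, EuclideanSpace.inner_single_left, map_one, one_mul]

open Classical in
theorem coord_deltaFock {k : ℕ} (α : G.Path k) {v : V} {l : List E} (h : G.IsPath v l) :
    coord G v l (deltaFock α) = if α.rng = v ∧ α.edges = l then 1 else 0 := by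
  rw [coord_of_isPath h]
  by_cases hl : l.length = k
  · subst hl
    rw [deltaFock, lp.single_apply_self]
    refine (PiLp.single_apply 2 ℂ α 1 _).trans (if_congr ⟨?_, ?_⟩ rfl rfl)
    · rintro rfl
      exact ⟨rfl, rfl⟩
    · exact fun h => DirGraph.Path.ext h.1.symm h.2.symm
  · rw [deltaFock, lp.single_apply_ne _ _ _ hl, if_neg]
    · rfl
    · rintro ⟨-, rfl⟩
      exact hl α.length_edges

theorem S_deltaFock {e : E} {k : ℕ} {β : G.Path k} (h : G.s e = β.rng) :
    (S G e).1 (deltaFock β) = deltaFock (DirGraph.Path.cons e β h) := by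
  classical
  refine Fock.ext_coord fun v l hl => ?_
  rw [coord_deltaFock _ hl]
  cases l with
  | nil => rw [coord_S_nil, if_neg fun h => List.cons_ne_nil _ _ h.2]
  | cons f l =>
    rw [coord_S_cons e f hl, coord_deltaFock _ hl.2, ← ite_and]
    refine if_congr ⟨?_, ?_⟩ rfl rfl
    · rintro ⟨rfl, -, rfl⟩
      exact ⟨hl.1, rfl⟩
    · rintro ⟨-, h'⟩
      obtain ⟨rfl, rfl⟩ := List.cons.inj h'
      exact ⟨rfl, h.symm, rfl⟩

theorem S_deltaFock_of_ne {e : E} {k : ℕ} {β : G.Path k} (h : G.s e ≠ β.rng) :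
    (S G e).1 (deltaFock β) = 0 := by
  classical
  refine Fock.ext_coord fun v l hl => ?_
  rw [map_zero]
  cases l with
  | nil => rw [coord_S_nil]
  | cons f l =>
    rw [coord_S_cons e f hl, coord_deltaFock _ hl.2, ← ite_and, if_neg]
    rintro ⟨rfl, h', -⟩
    exact h h'.symm

theorem star_S_apply {e : E} {k : ℕ} {β : G.Path k} (h : G.s e = β.rng) (ξ : Fock G) :
    (star (S G e)).1 ξ k β = ξ (k + 1) (DirGraph.Path.cons e β h) := by
  have hadj : inner ℂ (deltaFock β) ((star (S G e)).1 ξ) =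
      inner ℂ ((S G e).1 (deltaFock β)) ξ := ContinuousLinearMap.adjoint_inner_right _ _ _
  rw [← inner_deltaFock, hadj, S_deltaFock h, inner_deltaFock]

theorem star_S_apply_of_ne {e : E} {k : ℕ} {β : G.Path k} (h : G.s e ≠ β.rng) (ξ : Fock G) :
    (star (S G e)).1 ξ k β = 0 := by
  have hadj : inner ℂ (deltaFock β) ((star (S G e)).1 ξ) =
      inner ℂ ((S G e).1 (deltaFock β)) ξ := ContinuousLinearMap.adjoint_inner_right _ _ _
  rw [← inner_deltaFock, hadj, S_deltaFock_of_ne h, inner_zero_left]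

open Classical in
theorem coord_star_S (e : E) {v : V} {l : List E} (h : G.IsPath v l) (ξ : Fock G) :
    coord G v l ((star (S G e)).1 ξ) = if G.s e = v then coord G (G.r e) (e :: l) ξ else 0 := by
  rw [coord_of_isPath h]
  split_ifs with hv
  · exact (star_S_apply hv ξ).trans (apply_eq_coord _ _)
  · exact star_S_apply_of_ne hv ξ

/-! ### The Toeplitz relations in `𝓛(𝓕(X_E))` -/

theorem L.ext_coord {S T : L G}
    (h : ∀ ξ v l, G.IsPath v l → coord G v l (S.1 ξ) = coord G v l (T.1 ξ)) : S = T :=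
  Subtype.ext (ContinuousLinearMap.ext fun ξ => Fock.ext_coord (h ξ))

theorem L.mul_apply (S T : L G) (ξ : Fock G) : (S * T).1 ξ = S.1 (T.1 ξ) := rfl

theorem L.add_apply (S T : L G) (ξ : Fock G) : (S + T).1 ξ = S.1 ξ + T.1 ξ := rfl

theorem L.sub_apply (S T : L G) (ξ : Fock G) : (S - T).1 ξ = S.1 ξ - T.1 ξ := rfl

theorem L.one_apply (ξ : Fock G) : (1 : L G).1 ξ = ξ := rfl

theorem L.zero_apply (ξ : Fock G) : (0 : L G).1 ξ = 0 := rfl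

theorem L.sum_apply {ι : Type*} (s : Finset ι) (T : ι → L G) (ξ : Fock G) :
    (∑ i ∈ s, T i).1 ξ = ∑ i ∈ s, (T i).1 ξ := by
  rw [AddSubmonoidClass.coe_finsetSum, _root_.sum_apply]

theorem inner_leftX {k : ℕ} (a : V → ℂ) (ξ η : X G k) :
    inner ℂ (leftX G k a ξ) η = inner ℂ ξ (leftX G k (star a) η) := by
  simp only [PiLp.inner_apply, leftX_apply, Pi.star_apply, RCLike.inner_apply, map_mul]
  exact Finset.sum_congr rfl fun α _ => by rw [RCLike.star_def]; ring

theorem inner_leftFock (a : V → ℂ) (ξ η : Fock G) :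
    inner ℂ (leftFock G a ξ) η = inner ℂ ξ (leftFock G (star a) η) := by
  simp only [lp.inner_eq_tsum]
  exact tsum_congr fun k => inner_leftX a (ξ k) (η k)

theorem star_P (v : V) : star (P G v) = P G v := by
  classical
  refine Subtype.ext ((ContinuousLinearMap.eq_adjoint_iff _ _).2 fun ξ η => ?_).symm
  change inner ℂ (leftFock G (Pi.single v 1) ξ) η = inner ℂ ξ (leftFock G (Pi.single v 1) η)
  rw [inner_leftFock, ← Pi.single_star, star_one]

theorem P_mul_P_self (v : V) : P G v * P G v = P G v := by
  classical
  refine L.ext_coord fun ξ w l _ => ?_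
  rw [L.mul_apply, coord_P, coord_P]
  split_ifs <;> rfl

theorem P_mul_P_of_ne {v w : V} (h : v ≠ w) : P G v * P G w = 0 := by
  classical
  refine L.ext_coord fun ξ x l _ => ?_
  rw [L.mul_apply, coord_P, coord_P, L.zero_apply, map_zero]
  split_ifs with hv hw
  · exact absurd (hv.symm.trans hw) h
  all_goals rfl

theorem sum_P : ∑ v, P G v = 1 := by
  classical
  refine L.ext_coord fun ξ v l _ => ?_
  rw [L.sum_apply, map_sum]
  simp only [coord_P, Finset.sum_ite_eq, Finset.mem_univ, if_true]
  rfl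

theorem P_r_mul_S (e : E) : P G (G.r e) * S G e = S G e := by
  classical
  refine L.ext_coord fun ξ v l hl => ?_
  rw [L.mul_apply, coord_P]
  cases l with
  | nil => rw [coord_S_nil, ite_self]
  | cons f l =>
    rw [coord_S_cons e f hl, ← ite_and]
    refine if_congr ⟨And.right, ?_⟩ rfl rfl
    rintro rfl
    exact ⟨hl.1.symm, rfl⟩

theorem S_mul_P_s (e : E) : S G e * P G (G.s e) = S G e := by
  classical
  refine L.ext_coord fun ξ v l hl => ?_
  rw [L.mul_apply]
  cases l with
  | nil => rw [coord_S_nil, coord_S_nil]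
  | cons f l =>
    rw [coord_S_cons e f hl, coord_S_cons e f hl, coord_P]
    split_ifs with hf hs
    · rfl
    · exact absurd (congrArg G.s hf) hs
    · rfl

theorem star_S_mul_S_self (e : E) : star (S G e) * S G e = P G (G.s e) := by
  classical
  refine L.ext_coord fun ξ v l hl => ?_
  rw [L.mul_apply, coord_star_S e hl, coord_P]
  refine ite_congr (propext eq_comm) (fun hv => ?_) fun _ => rfl
  rw [coord_S_cons e e ⟨rfl, hv ▸ hl⟩, if_pos rfl, hv]

theorem star_S_mul_S_of_ne {e f : E} (h : e ≠ f) : star (S G e) * S G f = 0 := by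
  classical
  refine L.ext_coord fun ξ v l hl => ?_
  rw [L.mul_apply, coord_star_S e hl, L.zero_apply, map_zero]
  split_ifs with hv
  · rw [coord_S_cons f e ⟨rfl, hv ▸ hl⟩, if_neg h]
  · rfl

/-! ### Compact operators -/

open Classical in
variable (G) in
/-- The projection of `𝓕(X_E)` onto the closed span of the `δ_α` with `(r(α), α) ∈ A`, where a path
is given by its range and its list of edges. Varying `A` allows one to build the compact projections
up from those of rank one. -/
def supportProj (A : Set (V × List E)) : L G :=
  ⟨diag G (fun _ => mulX G fun α => if (α.rng, α.edges) ∈ A then 1 else 0)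
    ⟨1, fun _ => norm_mulX_le G zero_le_one fun _ => by split_ifs <;> simp⟩,
    mem_L_of_commute G fun a ξ => by
      apply lp.ext; funext k; ext α
      change _ * (_ * _) = _ * (_ * _)
      ring⟩

open Classical in
theorem coord_supportProj (A : Set (V × List E)) {v : V} {l : List E} (h : G.IsPath v l)
    (ξ : Fock G) :
    coord G v l ((supportProj G A).1 ξ) = if (v, l) ∈ A then coord G v l ξ else 0 := by
  rw [← one_mul (coord G v l ξ), ← zero_mul (coord G v l ξ), ← ite_mul, coord_of_isPath h,
    coord_of_isPath h]
  rfl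

theorem supportProj_empty : supportProj G ∅ = 0 :=
  L.ext_coord fun ξ v l h => by
    rw [coord_supportProj _ h, if_neg (Set.notMem_empty _), L.zero_apply, map_zero]

theorem supportProj_union {A B : Set (V × List E)} (hAB : Disjoint A B) :
    supportProj G (A ∪ B) = supportProj G A + supportProj G B := by
  classical
  refine L.ext_coord fun ξ v l h => ?_
  rw [coord_supportProj _ h, L.add_apply, map_add, coord_supportProj _ h, coord_supportProj _ h]
  by_cases hA : (v, l) ∈ A
  · rw [if_pos (Set.mem_union_left B hA), if_pos hA, if_neg (hAB.notMem_of_mem_left hA), add_zero]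
  · simp only [Set.mem_union, hA, false_or, if_false, zero_add]

theorem coord_rightFock (a : V → ℂ) {v : V} {l : List E} (h : G.IsPath v l) (ξ : Fock G) :
    coord G v l (rightFock G a ξ) = a (G.endpoint v l) * coord G v l ξ := by
  rw [coord_of_isPath h, coord_of_isPath h]
  rfl

theorem isTheta_supportProj_singleton {k : ℕ} (α : G.Path k) :
    IsTheta G (supportProj G {(α.rng, α.edges)}) := by
  classical
  refine ⟨deltaFock α, deltaFock α, fun ζ => Fock.ext_coord fun v l h => ?_⟩
  have hinner : innerA G (deltaFock α) ζ = Pi.single α.src (ζ k α) := by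
    funext w
    rw [innerA_eq, inner_deltaFock, rightFock_apply, Pi.single_apply, Pi.single_apply]
    simp only [eq_comm (a := w), ite_mul, one_mul, zero_mul]
  rw [coord_supportProj _ h, coord_rightFock _ h, hinner, coord_deltaFock _ h,
    Set.mem_singleton_iff, Prod.mk_inj]
  split_ifs with h₁ h₂ h₂
  · obtain ⟨rfl, rfl⟩ := h₁
    rw [mul_one, apply_eq_coord]
    exact (Pi.single_eq_same (M := fun _ => ℂ) α.src _).symm
  · exact absurd ⟨h₁.1.symm, h₁.2.symm⟩ h₂
  · exact absurd ⟨h₂.1.symm, h₂.2.symm⟩ h₁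
  · rw [mul_zero]

theorem supportProj_mem_K_of_finite {A : Set (V × List E)} (hA : A.Finite)
    (hpath : ∀ x ∈ A, G.IsPath x.1 x.2) : supportProj G A ∈ K G := by
  induction A, hA using Set.Finite.induction_on with
  | empty => rw [supportProj_empty]; exact (K G).zero_mem
  | @insert x A hx _ ih =>
    rw [Set.insert_eq, supportProj_union (Set.disjoint_singleton_left.2 hx)]
    refine (K G).add_mem ?_ (ih fun y hy => hpath y (Or.inr hy))
    exact subset_closure (Submodule.subset_span (isTheta_supportProj_singleton
      (⟨x, hpath x (Or.inl rfl), rfl⟩ : G.Path x.2.length)))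

variable (G) in
/-- The projection of `𝓕(X_E)` onto the span of the `δ_α` with `|α| < N`, a compact operator used to
approximate by cutting off high levels. -/
def levelProj (N : ℕ) : L G := supportProj G {x | G.IsPath x.1 x.2 ∧ x.2.length < N}

theorem levelProj_mem_K (N : ℕ) : levelProj G N ∈ K G := by
  refine supportProj_mem_K_of_finite ?_ fun x hx => hx.1
  refine (Set.finite_univ.prod (List.finite_length_lt E N)).subset fun x hx => ?_
  exact ⟨Set.mem_univ _, hx.2⟩

open Classical in
theorem coord_levelProj (N : ℕ) {v : V} {l : List E} (h : G.IsPath v l) (ξ : Fock G) :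
    coord G v l ((levelProj G N).1 ξ) = if l.length < N then coord G v l ξ else 0 := by
  simp only [levelProj, coord_supportProj _ h, Set.mem_ofPred_eq, h, true_and]

theorem one_sub_levelProj_apply (N : ℕ) (ξ : Fock G) (k : ℕ) :
    (1 - levelProj G N).1 ξ k = if k < N then 0 else ξ k := by
  ext α
  rw [apply_eq_coord, L.sub_apply, map_sub, coord_levelProj N α.isPath_edges, α.length_edges,
    L.one_apply]
  split_ifs with h
  · rw [sub_self]
    rfl
  · rw [sub_zero, apply_eq_coord]

theorem sum_S_mul_star_S : ∑ e, S G e * star (S G e) = 1 - levelProj G 1 := by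
  classical
  refine L.ext_coord fun ξ v l h => ?_
  simp only [L.sum_apply, L.sub_apply, L.one_apply, L.mul_apply, map_sum, map_sub,
    coord_levelProj 1 h]
  cases l with
  | nil => simp only [coord_S_nil, Finset.sum_const_zero, List.length_nil, zero_lt_one, if_true,
      sub_self]
  | cons f l =>
    simp only [coord_S_cons _ f h, Finset.sum_ite_eq, Finset.mem_univ, if_true,
      coord_star_S f h.2, h.1, List.length_cons, Nat.lt_one_iff, Nat.succ_ne_zero, if_false,
      sub_zero]

theorem isClosed_K : IsClosed (K G : Set (L G)) := isClosed_closure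

theorem mem_K_of_norm_mul_one_sub_levelProj_le {T : L G}
    (h : ∀ ε : ℝ, 0 < ε → ∃ N : ℕ, ‖T * (1 - levelProj G N)‖ ≤ ε) : T ∈ K G := by
  have hclosure : T ∈ closure (K G : Set (L G)) := by
    refine Metric.mem_closure_iff.2 fun ε hε => ?_
    obtain ⟨N, hN⟩ := h (ε / 2) (half_pos hε)
    refine ⟨T * levelProj G N, (K G).mul_mem_left _ (levelProj_mem_K N), ?_⟩
    rw [mul_sub, mul_one] at hN
    rw [dist_eq_norm]
    exact hN.trans_lt (half_lt_self hε)
  rwa [isClosed_K.closure_eq] at hclosure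

theorem L.norm_le_of_norm_apply_le {S T : L G} {δ : ℝ} (hδ : 0 ≤ δ)
    (h : ∀ ξ k, ‖S.1 ξ k‖ ≤ δ * ‖T.1 ξ k‖) : ‖S‖ ≤ δ * ‖T‖ := by
  refine ContinuousLinearMap.opNorm_le_bound _ (mul_nonneg hδ (norm_nonneg _)) fun ξ => ?_
  calc ‖S.1 ξ‖ ≤ ‖(δ : ℂ) • T.1 ξ‖ := lp.norm_mono two_ne_zero fun k => by
        rw [lp.coeFn_smul, Pi.smul_apply, norm_smul, Complex.norm_of_nonneg hδ]
        exact h ξ k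
    _ = δ * ‖T.1 ξ‖ := by rw [norm_smul, Complex.norm_of_nonneg hδ]
    _ ≤ δ * (‖T‖ * ‖ξ‖) := by gcongr; exact T.1.le_opNorm ξ
    _ = δ * ‖T‖ * ‖ξ‖ := (mul_assoc _ _ _).symm

/-! ### Weights and creation operators commute modulo compact operators -/

variable (G) in
/-- The product `S_{e₁} ⋯ S_{eₖ}` over a list of edges, which lifts `u_β` to the Fock correspondence
if these are the edges of a path `β` of positive length. -/
def SProd (l : List E) : L G := (l.map (S G)).prod

open Classical in
theorem coord_SProd (m : List E) {v : V} {l : List E} (h : G.IsPath v l) (ξ : Fock G) :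
    coord G v l ((SProd G m).1 ξ) =
      if m <+: l then coord G (G.endpoint v m) (l.drop m.length) ξ else 0 := by
  induction m generalizing v l with
  | nil =>
    rw [if_pos List.nil_prefix]
    rfl
  | cons e m ih =>
    rw [SProd, List.map_cons, List.prod_cons, L.mul_apply]
    cases l with
    | nil => rw [coord_S_nil, if_neg fun hnil => List.cons_ne_nil _ _ (List.prefix_nil.1 hnil)]
    | cons f l =>
      rw [coord_S_cons e f h]
      refine Eq.trans ?_ (if_congr List.cons_prefix_cons.symm rfl rfl)
      rw [ite_and]
      refine ite_congr (propext eq_comm) (fun hef => ?_) fun _ => rfl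
      subst hef
      exact ih h.2

section

variable {p k : ℕ}

open Classical in
theorem SProd_apply (β : G.Path p) (ξ : Fock G) (α : G.Path (p + k)) :
    (SProd G β.edges).1 ξ (p + k) α = if α.initial.edges = β.edges then ξ k α.final else 0 := by
  rw [apply_eq_coord, coord_SProd _ α.isPath_edges, apply_eq_coord, β.length_edges]
  have hprefix : β.edges <+: α.edges ↔ α.initial.edges = β.edges := by
    rw [List.prefix_iff_eq_take, β.length_edges, eq_comm]
    rfl
  refine ite_congr (propext hprefix) (fun h => ?_) fun _ => rfl
  rw [← h]
  rfl

theorem SProd_apply_of_lt (β : G.Path p) (ξ : Fock G) (hk : k < p) :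
    (SProd G β.edges).1 ξ k = 0 := by
  classical
  ext α
  rw [apply_eq_coord, coord_SProd _ α.isPath_edges, if_neg]
  · rfl
  · intro h
    have hle := h.length_le
    rw [β.length_edges, α.length_edges] at hle
    exact hk.not_ge hle

theorem SProd_apply_congr (β : G.Path p) {ξ η : Fock G} (h : ξ k = η k) :
    (SProd G β.edges).1 ξ (p + k) = (SProd G β.edges).1 η (p + k) := by
  classical
  ext α
  rw [SProd_apply, SProd_apply, h]

open Classical in
theorem sliceX_SProd (β γ : G.Path p) (ξ : Fock G) :
    sliceX G k γ ((SProd G β.edges).1 ξ (p + k)) =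
      if γ.edges = β.edges then leftX G k (Pi.single γ.src 1) (ξ k) else 0 := by
  ext α
  have hslice : sliceX G k γ ((SProd G β.edges).1 ξ (p + k)) α =
      if γ.src = α.rng then if γ.edges = β.edges then ξ k α else 0 else 0 := by
    by_cases h : γ.src = α.rng
    · refine (dif_pos h).trans ?_
      rw [SProd_apply, DirGraph.Path.initial_append, DirGraph.Path.final_append, if_pos h]
    · exact (dif_neg h).trans (if_neg h).symm
  rw [hslice]
  by_cases hγ : γ.edges = β.edges
  · rw [if_pos hγ, if_pos hγ, leftX_apply, Pi.single_apply, ite_mul, one_mul, zero_mul]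
    exact if_congr eq_comm rfl rfl
  · rw [if_neg hγ, if_neg hγ, ite_self]
    rfl

theorem idTensor_SProd {T : X G k →L[ℂ] X G k} (hT : ∀ a, T * leftX G k a = leftX G k a * T)
    (β : G.Path p) {ξ η : Fock G} (hη : η k = T (ξ k)) :
    idTensor G p T ((SProd G β.edges).1 ξ (p + k)) = (SProd G β.edges).1 η (p + k) := by
  classical
  ext α
  change T (sliceX G k α.initial ((SProd G β.edges).1 ξ (p + k))) α.final = _
  rw [sliceX_SProd, SProd_apply, hη]
  split_ifs
  · have hcomm : T (leftX G k (Pi.single α.initial.src 1) (ξ k)) =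
        leftX G k (Pi.single α.initial.src 1) (T (ξ k)) :=
      DFunLike.congr_fun (hT (Pi.single α.initial.src 1)) (ξ k)
    have hrng : α.final.rng = α.initial.src := rfl
    rw [hcomm, leftX_apply, hrng, Pi.single_eq_same, one_mul]
  · rw [map_zero]
    rfl

theorem WeightSequence.op_apply (W : WeightSequence G) (ξ : Fock G) (k : ℕ) :
    W.op.1 ξ k = W.Z k (ξ k) := rfl

theorem WeightSequence.commutator_apply (W : WeightSequence G) (β : G.Path p) (ξ : Fock G) :
    (W.op * SProd G β.edges - SProd G β.edges * W.op).1 ξ (p + k) =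
      (W.Z (p + k) - idTensor G p (W.Z k)) ((SProd G β.edges).1 ξ (p + k)) := by
  rw [_root_.sub_apply, idTensor_SProd (W.commute_left k) β (W.op_apply ξ k)]
  rfl

theorem WeightSequence.commutator_apply_of_lt (W : WeightSequence G) (β : G.Path p) (ξ : Fock G)
    (hk : k < p) : (W.op * SProd G β.edges - SProd G β.edges * W.op).1 ξ k = 0 := by
  change W.Z k ((SProd G β.edges).1 ξ k) - (SProd G β.edges).1 (W.op.1 ξ) k = 0
  rw [SProd_apply_of_lt β _ hk, SProd_apply_of_lt β _ hk, map_zero, sub_zero]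

theorem WeightSequence.norm_commutator_mul_one_sub_levelProj_le (W : WeightSequence G)
    (β : G.Path p) {δ : ℝ} (hδ : 0 ≤ δ) {N : ℕ}
    (hN : ∀ k, N ≤ k → ‖idTensor G p (W.Z k) - W.Z (p + k)‖ ≤ δ) :
    ‖(W.op * SProd G β.edges - SProd G β.edges * W.op) * (1 - levelProj G N)‖ ≤
      δ * ‖SProd G β.edges‖ := by
  refine L.norm_le_of_norm_apply_le hδ fun ξ j => ?_
  rw [L.mul_apply]
  rcases lt_or_ge j p with hj | hj
  · rw [W.commutator_apply_of_lt β _ hj, norm_zero]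
    positivity
  obtain ⟨k, rfl⟩ := Nat.exists_eq_add_of_le hj
  rw [W.commutator_apply]
  have hξ := one_sub_levelProj_apply N ξ k
  split_ifs at hξ with hk
  · have hzero : (SProd G β.edges).1 ((1 - levelProj G N).1 ξ) (p + k) = 0 := by
      rw [SProd_apply_congr β (η := 0) hξ, map_zero]
      rfl
    rw [hzero, map_zero, norm_zero]
    positivity
  · rw [SProd_apply_congr β hξ]
    refine ContinuousLinearMap.le_of_opNorm_le _ ?_ _
    rw [norm_sub_rev]
    exact hN k (not_lt.1 hk)

theorem WeightSequence.commutator_mem_K {W : WeightSequence G} (hA : ConditionA W p)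
    (β : G.Path p) : W.op * SProd G β.edges - SProd G β.edges * W.op ∈ K G := by
  refine mem_K_of_norm_mul_one_sub_levelProj_le fun ε hε => ?_
  set δ := ε / (‖SProd G β.edges‖ + 1)
  have hδ : 0 < δ := by positivity
  obtain ⟨N, hN⟩ := Filter.eventually_atTop.1 (hA.eventually_le_const hδ)
  refine ⟨N, (W.norm_commutator_mul_one_sub_levelProj_le β hδ.le hN).trans ?_⟩
  calc δ * ‖SProd G β.edges‖ ≤ δ * (‖SProd G β.edges‖ + 1) := by gcongr; linarith
    _ = ε := div_mul_cancel₀ ε (by positivity)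

end

/-! ### Cuntz–Krieger relations in the quotient -/

theorem isQuotientMap_q : Topology.IsQuotientMap (q G) := isQuotientMap_quotient_mk'

theorem q_eq_zero_iff {T : L G} : q G T = 0 ↔ T ∈ K G := Ideal.Quotient.eq_zero_iff_mem

theorem isClosed_singleton_zero : IsClosed ({0} : Set (LK G)) := by
  rw [← isQuotientMap_q.isClosed_preimage]
  convert isClosed_K (G := G)
  exact Set.ext fun T => q_eq_zero_iff

theorem continuous_mul_mul (a b : LK G) : Continuous fun x : LK G => a * x * b := by
  obtain ⟨S, rfl⟩ := q_surjective G a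
  obtain ⟨T, rfl⟩ := q_surjective G b
  refine isQuotientMap_q.continuous_iff.2 ?_
  have hlift : (fun x : LK G => q G S * x * q G T) ∘ q G = fun x => q G (S * x * T) :=
    funext fun x => by simp only [Function.comp_apply, map_mul]
  rw [hlift]
  exact isQuotientMap_q.continuous.comp (by fun_prop)

variable (G) in
/-- The element `u_v = q(P_v)` for a vertex `v`, which is `u_α` for the path `α = v` of
length `0`. -/
def uVertex (v : V) : LK G := q G (P G v)

theorem star_uVertex (v : V) : star (uVertex G v) = uVertex G v := by
  rw [uVertex, star_q, star_P]

theorem uVertex_mul_self (v : V) : uVertex G v * uVertex G v = uVertex G v := by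
  rw [uVertex, ← map_mul, P_mul_P_self]

theorem uVertex_mul_of_ne {v w : V} (h : v ≠ w) : uVertex G v * uVertex G w = 0 := by
  rw [uVertex, uVertex, ← map_mul, P_mul_P_of_ne h, map_zero]

theorem sum_uVertex : ∑ v, uVertex G v = 1 := by
  simp only [uVertex, ← map_sum, sum_P, map_one]

theorem uVertex_r_mul_u (e : E) : uVertex G (G.r e) * u G e = u G e := by
  rw [uVertex, u, ← map_mul, P_r_mul_S]

theorem u_mul_uVertex_s (e : E) : u G e * uVertex G (G.s e) = u G e := by
  rw [uVertex, u, ← map_mul, S_mul_P_s]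

theorem star_u_mul_self (e : E) : star (u G e) * u G e = uVertex G (G.s e) := by
  rw [u, uVertex, star_q, ← map_mul, star_S_mul_S_self]

theorem star_u_mul_of_ne {e f : E} (h : e ≠ f) : star (u G e) * u G f = 0 := by
  rw [u, u, star_q, ← map_mul, star_S_mul_S_of_ne h, map_zero]

theorem sum_u_mul_star : ∑ e, u G e * star (u G e) = 1 := by
  simp only [u, star_q, ← map_mul, ← map_sum]
  rw [sum_S_mul_star_S, map_sub, map_one, q_eq_zero_iff.2 (levelProj_mem_K 1), sub_zero]

theorem WeightSequence.commute_z_uVertex (W : WeightSequence G) (v : V) :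
    Commute W.z (uVertex G v) := by
  classical
  have hop : W.op * P G v = P G v * W.op :=
    Subtype.ext (ContinuousLinearMap.ext fun ξ => lp.ext (funext fun k =>
      DFunLike.congr_fun (W.commute_left k (Pi.single v 1)) (ξ k)))
  rw [Commute, SemiconjBy, z, uVertex, ← map_mul, hop, map_mul]

/-! ### The elements `u_α` -/

section

variable {j k : ℕ}

theorem uPath_ofVertex (v : V) : uPath (DirGraph.Path.ofVertex G v) = uVertex G v := rfl

theorem uPath_eq_uVertex_mul_prod (α : G.Path k) :
    uPath α = uVertex G α.rng * (α.edges.map (u G)).prod := by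
  obtain ⟨⟨v, l⟩, h, rfl⟩ := α
  cases l with
  | nil => exact (mul_one _).symm
  | cons e l =>
    change ((e :: l).map (u G)).prod = uVertex G v * ((e :: l).map (u G)).prod
    obtain rfl : G.r e = v := h.1
    rw [List.map_cons, List.prod_cons, ← mul_assoc, uVertex_r_mul_u]

theorem uVertex_rng_mul_uPath (α : G.Path k) : uVertex G α.rng * uPath α = uPath α := by
  rw [uPath_eq_uVertex_mul_prod, ← mul_assoc, uVertex_mul_self]

theorem uPath_eq_u_head_mul_uPath_tail (α : G.Path (k + 1)) :
    uPath α = u G α.head * uPath α.tail := by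
  have hrng : α.tail.rng = G.s α.head := rfl
  rw [uPath_eq_uVertex_mul_prod, uPath_eq_uVertex_mul_prod, α.edges_eq_cons, List.map_cons,
    List.prod_cons, ← mul_assoc, ← mul_assoc, ← α.r_head, uVertex_r_mul_u, hrng, u_mul_uVertex_s]

theorem uPath_mul_uVertex_src (α : G.Path k) : uPath α * uVertex G α.src = uPath α := by
  induction k with
  | zero =>
    rw [α.eq_ofVertex]
    exact uVertex_mul_self _
  | succ k ih =>
    rw [uPath_eq_u_head_mul_uPath_tail, mul_assoc, ← α.src_tail, ih]

theorem uPath_mul_uPath_of_ne {α : G.Path j} {β : G.Path k} (h : α.src ≠ β.rng) :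
    uPath α * uPath β = 0 := by
  rw [← uPath_mul_uVertex_src α, ← uVertex_rng_mul_uPath β, mul_assoc,
    ← mul_assoc (uVertex G α.src), uVertex_mul_of_ne h, zero_mul, mul_zero]

theorem u_mul_uPath_of_ne {e : E} {β : G.Path k} (h : G.s e ≠ β.rng) : u G e * uPath β = 0 := by
  rw [← u_mul_uVertex_s, ← uVertex_rng_mul_uPath β, mul_assoc, ← mul_assoc (uVertex G (G.s e)),
    uVertex_mul_of_ne h, zero_mul, mul_zero]

theorem uPath_append (α : G.Path j) (β : G.Path k) (h : α.src = β.rng) :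
    uPath (α.append β h) = uPath α * uPath β := by
  have hprod : uPath (α.append β h) = uPath α * (β.edges.map (u G)).prod := by
    rw [uPath_eq_uVertex_mul_prod α, mul_assoc, ← List.prod_append, ← List.map_append]
    exact uPath_eq_uVertex_mul_prod (α.append β h)
  rw [hprod, uPath_eq_uVertex_mul_prod β, ← mul_assoc, ← h, uPath_mul_uVertex_src]

theorem uPath_eq_uPath_initial_mul_uPath_final (α : G.Path (j + k)) :
    uPath α = uPath α.initial * uPath α.final := by
  rw [← uPath_append _ _ rfl, α.append_initial_final]

theorem uPath_cons (e : E) (β : G.Path k) (h : G.s e = β.rng) :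
    uPath (β.cons e h) = u G e * uPath β := by
  rw [uPath_eq_u_head_mul_uPath_tail, β.tail_cons e h]
  rfl

theorem uPath_ofEdge (e : E) : uPath (DirGraph.Path.ofEdge (G := G) e) = u G e := mul_one _

theorem uPath_snoc (μ : G.Path k) (e : E) (h : μ.src = G.r e) :
    uPath (μ.snoc e h) = uPath μ * u G e := by
  rw [← uPath_ofEdge e]
  exact uPath_append μ (DirGraph.Path.ofEdge e) h

theorem star_uPath_mul_self (α : G.Path k) : star (uPath α) * uPath α = uVertex G α.src := by
  induction k with
  | zero =>
    rw [α.eq_ofVertex, uPath_ofVertex, star_uVertex]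
    exact uVertex_mul_self _
  | succ k ih =>
    have hrng : G.s α.head = α.tail.rng := rfl
    rw [uPath_eq_u_head_mul_uPath_tail, star_mul, mul_assoc, ← mul_assoc (star (u G α.head)),
      star_u_mul_self, hrng, uVertex_rng_mul_uPath, ih, α.src_tail]

theorem star_uPath_mul_of_ne {α β : G.Path k} (h : α ≠ β) : star (uPath α) * uPath β = 0 := by
  induction k with
  | zero =>
    rw [α.eq_ofVertex, β.eq_ofVertex, uPath_ofVertex, uPath_ofVertex, star_uVertex]
    exact uVertex_mul_of_ne fun hrng =>
      h (DirGraph.Path.ext hrng (α.edges_of_length_zero.trans β.edges_of_length_zero.symm))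
  | succ k ih =>
    rw [uPath_eq_u_head_mul_uPath_tail α, uPath_eq_u_head_mul_uPath_tail β, star_mul, mul_assoc,
      ← mul_assoc (star (u G α.head))]
    by_cases hhead : α.head = β.head
    · have htail : α.tail ≠ β.tail := fun ht => h (DirGraph.Path.head_tail_injective hhead ht)
      have hrng : G.s β.head = β.tail.rng := rfl
      rw [hhead, star_u_mul_self, hrng, uVertex_rng_mul_uPath, ih htail]
    · rw [star_u_mul_of_ne hhead, zero_mul, mul_zero]

theorem sum_uPath_mul_star (k : ℕ) : ∑ α : G.Path k, uPath α * star (uPath α) = 1 := by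
  classical
  induction k with
  | zero =>
    rw [← sum_uVertex]
    refine Fintype.sum_equiv ⟨DirGraph.Path.rng, DirGraph.Path.ofVertex G,
      fun α => α.eq_ofVertex.symm, fun _ => rfl⟩ _ _ fun α => ?_
    rw [α.eq_ofVertex, uPath_ofVertex, star_uVertex]
    exact uVertex_mul_self _
  | succ k ih =>
    have hpairs : ∑ x : E × G.Path k, u G x.1 * uPath x.2 * star (u G x.1 * uPath x.2) = 1 := by
      simp only [Fintype.sum_prod_type, star_mul, mul_assoc, ← Finset.mul_sum]
      simp only [← mul_assoc (uPath _), ← Finset.sum_mul, ih, one_mul, sum_u_mul_star]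
    rw [← hpairs]
    refine Finset.sum_of_injOn (fun α : G.Path (k + 1) => (α.head, α.tail)) ?_ ?_ ?_ ?_
    · intro α _ β _ h
      exact DirGraph.Path.head_tail_injective (congrArg Prod.fst h) (congrArg Prod.snd h)
    · exact fun _ _ => Finset.mem_coe.2 (Finset.mem_univ _)
    · rintro ⟨e, β⟩ - hβ
      have hne : G.s e ≠ β.rng := fun h =>
        hβ ⟨β.cons e h, Finset.mem_coe.2 (Finset.mem_univ _), Prod.ext rfl (β.tail_cons e h)⟩
      rw [u_mul_uPath_of_ne hne, zero_mul]
    · exact fun α _ => by rw [uPath_eq_u_head_mul_uPath_tail]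

theorem eq_zero_of_forall_mul_uPath (k : ℕ) {x : LK G} (h : ∀ α : G.Path k, x * uPath α = 0) :
    x = 0 := by
  rw [← mul_one x, ← sum_uPath_mul_star k, Finset.mul_sum]
  exact Finset.sum_eq_zero fun α _ => by rw [← mul_assoc, h, zero_mul]

theorem eq_zero_of_forall_star_uPath_mul (k : ℕ) {x : LK G}
    (h : ∀ α : G.Path k, star (uPath α) * x = 0) : x = 0 := by
  rw [← one_mul x, ← sum_uPath_mul_star k, Finset.sum_mul]
  exact Finset.sum_eq_zero fun α _ => by rw [mul_assoc, h, mul_zero]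

/-! ### Commutation of the weight with paths of length `p` -/

variable {W : WeightSequence G} {p : ℕ}

theorem commute_z_uPath (hA : ConditionA W p) (α : G.Path p) : Commute W.z (uPath α) := by
  have hprod : q G (SProd G α.edges) = (α.edges.map (u G)).prod := by
    rw [SProd, map_list_prod, List.map_map]
    rfl
  have hcomm : Commute W.z (q G (SProd G α.edges)) := by
    rw [Commute, SemiconjBy, WeightSequence.z, ← map_mul, ← map_mul, ← sub_eq_zero, ← map_sub,
      q_eq_zero_iff]
    exact W.commutator_mem_K hA α
  rw [uPath_eq_uVertex_mul_prod, ← hprod]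
  exact (W.commute_z_uVertex α.rng).mul_right hcomm

theorem star_uPath_mul_z_pow_mul_uPath_of_ne (hA : ConditionA W p) (hj : j ≤ p) (l : ℕ)
    {α β : G.Path j} (h : α ≠ β) : star (uPath α) * W.z ^ l * uPath β = 0 := by
  -- Extend `α` and `β` to paths of length `p`, since `z` commutes with these.
  obtain ⟨i, rfl⟩ := Nat.exists_eq_add_of_le hj
  refine eq_zero_of_forall_mul_uPath i fun γ => eq_zero_of_forall_star_uPath_mul i fun δ => ?_
  have hassoc : star (uPath δ) * (star (uPath α) * W.z ^ l * uPath β * uPath γ) =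
      star (uPath α * uPath δ) * W.z ^ l * (uPath β * uPath γ) := by
    simp only [star_mul, mul_assoc]
  rw [hassoc]
  by_cases hδ : α.src = δ.rng
  · by_cases hγ : β.src = γ.rng
    · have hne : α.append δ hδ ≠ β.append γ hγ := fun heq =>
        h (by rw [← α.initial_append δ hδ, heq, β.initial_append γ hγ])
      rw [← uPath_append _ _ hδ, ← uPath_append _ _ hγ, mul_assoc,
        ((commute_z_uPath hA _).pow_left l).eq, ← mul_assoc, star_uPath_mul_of_ne hne, zero_mul]
    · rw [uPath_mul_uPath_of_ne hγ, mul_zero]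
  · rw [uPath_mul_uPath_of_ne hδ, star_zero, zero_mul, zero_mul]

end

/-! ### Matrix units -/

section

variable {i j k m : ℕ}

/-- The element `u_α u_β^*`. For paths of a fixed length and with a fixed source these elements form
a system of matrix units; the lengths of `α` and `β` may differ, so that they also compare matrix
units of different sizes. -/
def matrixUnit (α : G.Path j) (β : G.Path k) : LK G := uPath α * star (uPath β)

theorem star_matrixUnit (α : G.Path j) (β : G.Path k) :
    star (matrixUnit α β) = matrixUnit β α := by
  rw [matrixUnit, star_mul, star_star, matrixUnit]

theorem matrixUnit_mul_uPath {α : G.Path j} {β : G.Path k} (h : α.src = β.src) :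
    matrixUnit α β * uPath β = uPath α := by
  rw [matrixUnit, mul_assoc, star_uPath_mul_self, ← h, uPath_mul_uVertex_src]

theorem matrixUnit_mul_matrixUnit {α : G.Path i} {β : G.Path j} (h : α.src = β.src)
    (γ : G.Path k) : matrixUnit α β * matrixUnit β γ = matrixUnit α γ := by
  rw [matrixUnit.eq_1 β γ, ← mul_assoc, matrixUnit_mul_uPath h, matrixUnit]

theorem matrixUnit_mul_matrixUnit_of_ne (α : G.Path i) {β γ : G.Path j} (h : β ≠ γ)
    (δ : G.Path k) : matrixUnit α β * matrixUnit γ δ = 0 := by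
  rw [matrixUnit, matrixUnit, mul_assoc, ← mul_assoc (star _), star_uPath_mul_of_ne h, zero_mul,
    mul_zero]

theorem matrixUnit_sandwich {i' j' k' : ℕ} {α : G.Path i} {β : G.Path j} {β' : G.Path j'}
    {α' : G.Path i'} (h : α.src = β.src) (h' : α'.src = β'.src) (γ : G.Path k) (γ' : G.Path k')
    (x : LK G) :
    matrixUnit α β * (matrixUnit β γ * x * matrixUnit γ' β') * matrixUnit β' α' =
      matrixUnit α γ * x * matrixUnit γ' α' := by
  have hright : matrixUnit γ' β' * matrixUnit β' α' = matrixUnit γ' α' := by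
    rw [← star_matrixUnit, ← star_matrixUnit α', ← star_mul, matrixUnit_mul_matrixUnit h',
      star_matrixUnit]
  rw [← hright, ← matrixUnit_mul_matrixUnit h γ]
  simp only [mul_assoc]

theorem mul_eq_sum_mul_matrixUnit_mul (k : ℕ) (x y : LK G) :
    x * y = ∑ γ : G.Path k, x * matrixUnit γ γ * y := by
  rw [← Finset.sum_mul, ← Finset.mul_sum]
  simp only [matrixUnit, sum_uPath_mul_star, mul_one]

theorem eq_sum_matrixUnit_mul_mul (k : ℕ) (x : LK G) :
    x = ∑ γ : G.Path k, ∑ δ : G.Path k, matrixUnit γ γ * x * matrixUnit δ δ := by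
  simp only [← Finset.mul_sum, ← Finset.sum_mul]
  simp only [matrixUnit, sum_uPath_mul_star, one_mul, mul_one]

variable {n p : ℕ} (ξ : V → G.Path (p - 1))

theorem tau_apply_of_src_eq (c : LK G) {γ₁ γ₂ : G.Path (n * p + (p - 1))}
    (h : γ₁.src = γ₂.src) :
    tau ξ n c γ₁ γ₂ = matrixUnit (ξ γ₁.src) γ₁ * c * matrixUnit γ₂ (ξ γ₁.src) := by
  rw [tau, Matrix.of_apply, if_pos h, ← h, mul_assoc (_ * c)]
  rfl

theorem tau_apply_of_src_ne (c : LK G) {γ₁ γ₂ : G.Path (n * p + (p - 1))}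
    (h : γ₁.src ≠ γ₂.src) : tau ξ n c γ₁ γ₂ = 0 := by
  rw [tau, Matrix.of_apply, if_neg h]

end

/-! ### The algebras `C_n` -/

theorem generatedCStar_induction {M : Set (LK G)} {Q : LK G → Prop} (mem : ∀ x ∈ M, Q x)
    (zero : Q 0) (add : ∀ x y, Q x → Q y → Q (x + y)) (mul : ∀ x y, Q x → Q y → Q (x * y))
    (smul : ∀ (t : ℂ) x, Q x → Q (t • x)) (star : ∀ x, Q x → Q (star x))
    (isClosed : IsClosed {x | Q x}) {c : LK G} (hc : c ∈ generatedCStar G M) : Q c := by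
  let B : NonUnitalStarSubalgebra ℂ (LK G) :=
    { carrier := {x | Q x}
      zero_mem' := zero
      add_mem' := add _ _
      mul_mem' := mul _ _
      smul_mem' := fun t x => smul t x
      star_mem' := star _ }
  have hB : generatedCStar G M ≤ B := sInf_le ⟨isClosed, mem⟩
  exact hB hc

theorem isClosed_generatedCStar (M : Set (LK G)) :
    IsClosed (generatedCStar G M : Set (LK G)) := by
  rw [generatedCStar, NonUnitalStarAlgebra.coe_sInf]
  exact isClosed_biInter fun S hS => hS.1

theorem subset_generatedCStar (M : Set (LK G)) : M ⊆ generatedCStar G M := by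
  rw [generatedCStar, NonUnitalStarAlgebra.coe_sInf]
  exact Set.subset_iInter₂ fun S hS => hS.2

section

variable {i j k m m' n n' p : ℕ} {W : WeightSequence G}

theorem uPath_mul_z_pow_mul_star_mem_C (hk : n * p ≤ k) (hk' : k < (n + 1) * p) (l : ℕ)
    {α β : G.Path k} (h : α.src = β.src) : uPath α * W.z ^ l * star (uPath β) ∈ C W p n :=
  subset_generatedCStar _ ⟨l, k, α, β, hk, hk', h, rfl⟩

theorem matrixUnit_mem_C (hk : n * p ≤ k) (hk' : k < (n + 1) * p) {α β : G.Path k}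
    (h : α.src = β.src) : matrixUnit α β ∈ C W p n := by
  have hmem := uPath_mul_z_pow_mul_star_mem_C (W := W) hk hk' 0 h
  rwa [pow_zero, mul_one] at hmem

theorem star_uPath_mul_uPath_of_initial_ne {α : G.Path k} {μ : G.Path (k + j)}
    (h : α ≠ μ.initial) : star (uPath α) * uPath μ = 0 := by
  rw [uPath_eq_uPath_initial_mul_uPath_final, ← mul_assoc, star_uPath_mul_of_ne h, zero_mul]

theorem star_uPath_mul_uPath_append {α : G.Path k} {β : G.Path j} (h : α.src = β.rng) :
    star (uPath α) * uPath (α.append β h) = uPath β := by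
  rw [uPath_append, ← mul_assoc, star_uPath_mul_self, h, uVertex_rng_mul_uPath]

theorem star_uPath_initial_mul_uPath (μ : G.Path (k + j)) :
    star (uPath μ.initial) * uPath μ = uPath μ.final := by
  have hsrc : μ.initial.src = μ.final.rng := rfl
  rw [uPath_eq_uPath_initial_mul_uPath_final, ← mul_assoc, star_uPath_mul_self, hsrc,
    uVertex_rng_mul_uPath]

theorem matrixUnit_mul_generator_mul_matrixUnit_mem_C (hG : G.NoSinks) (hi : n * p ≤ i)
    (hij : i + j < (n + 1) * p) (l : ℕ) {α β : G.Path k} (h : α.src = β.src)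
    (μ₁ μ₂ : G.Path (k + j)) {ν₁ ν₂ : G.Path (i + j)} (h₁ : ν₁.src = μ₁.src)
    (h₂ : ν₂.src = μ₂.src) :
    matrixUnit ν₁ μ₁ * (uPath α * W.z ^ l * star (uPath β)) * matrixUnit μ₂ ν₂ ∈ C W p n := by
  have hassoc : matrixUnit ν₁ μ₁ * (uPath α * W.z ^ l * star (uPath β)) * matrixUnit μ₂ ν₂ =
      uPath ν₁ * star (star (uPath α) * uPath μ₁) * W.z ^ l * (star (uPath β) * uPath μ₂) *
        star (uPath ν₂) := by
    simp only [matrixUnit, star_mul, star_star, mul_assoc]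
  rw [hassoc]
  obtain rfl | hα := eq_or_ne α μ₁.initial
  swap
  · simp only [star_uPath_mul_uPath_of_initial_ne hα, star_zero, mul_zero, zero_mul, zero_mem]
  obtain rfl | hβ := eq_or_ne β μ₂.initial
  swap
  · simp only [star_uPath_mul_uPath_of_initial_ne hβ, mul_zero, zero_mul, zero_mem]
  obtain ⟨ζ, hζ⟩ := DirGraph.Path.exists_src_eq hG i μ₁.initial.src
  have hζ₁ : ζ.src = μ₁.final.rng := hζ
  have hζ₂ : ζ.src = μ₂.final.rng := hζ.trans h
  have hν₁ : ν₁.src = (ζ.append μ₁.final hζ₁).src := by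
    rw [h₁, DirGraph.Path.src_append, DirGraph.Path.src_final]
  have hν₂ : (ζ.append μ₂.final hζ₂).src = ν₂.src := by
    rw [h₂, DirGraph.Path.src_append, DirGraph.Path.src_final]
  have hle : n * p ≤ i + j := hi.trans (Nat.le_add_right i j)
  have hfactor := mul_mem (mul_mem (matrixUnit_mem_C (W := W) hle hij hν₁)
    (uPath_mul_z_pow_mul_star_mem_C (W := W) hi ((Nat.le_add_right i j).trans_lt hij) l
      (rfl : ζ.src = ζ.src))) (matrixUnit_mem_C (W := W) hle hij hν₂)
  rw [star_uPath_initial_mul_uPath, star_uPath_initial_mul_uPath,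
    ← star_uPath_mul_uPath_append hζ₁, ← star_uPath_mul_uPath_append hζ₂]
  simpa only [matrixUnit, star_mul, star_star, mul_assoc] using hfactor

theorem matrixUnit_mul_mul_matrixUnit_mem_C (hG : G.NoSinks) (hm : m + 1 = (n + 1) * p)
    (hm' : m' + 1 = (n' + 1) * p) {c : LK G} (hc : c ∈ C W p n) {μ₁ μ₂ : G.Path m}
    {ν₁ ν₂ : G.Path m'} (h₁ : ν₁.src = μ₁.src) (h₂ : ν₂.src = μ₂.src) :
    matrixUnit ν₁ μ₁ * c * matrixUnit μ₂ ν₂ ∈ C W p n' := by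
  refine generatedCStar_induction (Q := fun c => ∀ {μ₁ μ₂ : G.Path m} {ν₁ ν₂ : G.Path m'},
    ν₁.src = μ₁.src → ν₂.src = μ₂.src → matrixUnit ν₁ μ₁ * c * matrixUnit μ₂ ν₂ ∈ C W p n')
    ?mem ?zero ?add ?mul ?smul ?star ?isClosed hc h₁ h₂
  case mem =>
    rintro x ⟨l, k, α, β, hk, hk', h, rfl⟩ μ₁ μ₂ ν₁ ν₂ h₁ h₂
    obtain ⟨j, rfl⟩ := Nat.exists_eq_add_of_le (show k ≤ m by omega)
    rw [Nat.succ_mul] at hm hm'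
    obtain ⟨i, rfl⟩ := Nat.exists_eq_add_of_le' (show j ≤ m' by omega)
    exact matrixUnit_mul_generator_mul_matrixUnit_mem_C hG (by omega)
      (by rw [Nat.succ_mul]; omega) l h μ₁ μ₂ h₁ h₂
  case zero => intros; simp only [mul_zero, zero_mul, zero_mem]
  case add =>
    intro x y hx hy μ₁ μ₂ ν₁ ν₂ h₁ h₂
    simpa only [mul_add, add_mul] using add_mem (hx h₁ h₂) (hy h₁ h₂)
  case mul =>
    intro x y hx hy μ₁ μ₂ ν₁ ν₂ h₁ h₂
    rw [mul_eq_sum_mul_matrixUnit_mul m x y, Finset.mul_sum, Finset.sum_mul]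
    refine sum_mem fun μ _ => ?_
    obtain ⟨ν, hν⟩ := DirGraph.Path.exists_src_eq hG m' μ.src
    rw [← matrixUnit_mul_matrixUnit hν.symm μ]
    simpa only [mul_assoc] using mul_mem (hx h₁ hν) (hy hν h₂)
  case smul =>
    intro t x hx μ₁ μ₂ ν₁ ν₂ h₁ h₂
    simpa only [mul_smul_comm, smul_mul_assoc] using SMulMemClass.smul_mem t (hx h₁ h₂)
  case star =>
    intro x hx μ₁ μ₂ ν₁ ν₂ h₁ h₂
    simpa only [star_mul, star_matrixUnit, mul_assoc] using star_mem (hx h₂ h₁)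
  case isClosed =>
    simp only [Set.ofPred_forall]
    exact isClosed_iInter fun _ => isClosed_iInter fun _ => isClosed_iInter fun _ =>
      isClosed_iInter fun _ => isClosed_iInter fun _ => isClosed_iInter fun _ =>
        (isClosed_generatedCStar _).preimage (continuous_mul_mul _ _)

theorem star_uPath_mul_generator_mul_uPath_of_last_ne (hA : ConditionA W p) (hj : j + 1 ≤ p)
    (l : ℕ) (α β : G.Path k) (μ₁ μ₂ : G.Path (k + (j + 1)))
    (h : DirGraph.Path.last (k := k + j) μ₁ ≠ DirGraph.Path.last (k := k + j) μ₂) :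
    star (uPath μ₁) * (uPath α * W.z ^ l * star (uPath β)) * uPath μ₂ = 0 := by
  have hassoc : star (uPath μ₁) * (uPath α * W.z ^ l * star (uPath β)) * uPath μ₂ =
      star (star (uPath α) * uPath μ₁) * W.z ^ l * (star (uPath β) * uPath μ₂) := by
    simp only [star_mul, star_star, mul_assoc]
  rw [hassoc]
  obtain rfl | hα := eq_or_ne α μ₁.initial
  swap
  · rw [star_uPath_mul_uPath_of_initial_ne hα, star_zero, zero_mul, zero_mul]
  obtain rfl | hβ := eq_or_ne β μ₂.initial
  swap
  · rw [star_uPath_mul_uPath_of_initial_ne hβ, mul_zero]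
  have hfinal : μ₁.final ≠ μ₂.final := fun heq =>
    h (by rw [← DirGraph.Path.last_final, heq, DirGraph.Path.last_final])
  rw [star_uPath_initial_mul_uPath, star_uPath_initial_mul_uPath,
    star_uPath_mul_z_pow_mul_uPath_of_ne hA hj l hfinal]

theorem star_uPath_mul_mul_uPath_of_last_ne (hA : ConditionA W p) (hm : m + 1 = (n + 1) * p)
    {c : LK G} (hc : c ∈ C W p n) {ν₁ ν₂ : G.Path (m + 1)} (h : ν₁.last ≠ ν₂.last) :
    star (uPath ν₁) * c * uPath ν₂ = 0 := by
  refine generatedCStar_induction (Q := fun c => ∀ {α β : G.Path (m + 1)}, α.last ≠ β.last →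
    star (uPath α) * c * uPath β = 0) ?mem ?zero ?add ?mul ?smul ?star ?isClosed hc h
  case mem =>
    rintro x ⟨l, k, α, β, hk, hk', -, rfl⟩ μ₁ μ₂ hlast
    obtain ⟨j, rfl⟩ := Nat.exists_eq_add_of_le (show k ≤ m by omega)
    rw [Nat.succ_mul] at hm
    exact star_uPath_mul_generator_mul_uPath_of_last_ne (j := j) hA (by omega) l α β _ _ hlast
  case zero => intros; simp only [mul_zero, zero_mul]
  case add =>
    intro x y hx hy α β h
    rw [mul_add, add_mul, hx h, hy h, add_zero]
  case mul =>
    intro x y hx hy α β h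
    rw [mul_eq_sum_mul_matrixUnit_mul (m + 1) x y, Finset.mul_sum, Finset.sum_mul]
    refine Finset.sum_eq_zero fun γ _ => ?_
    have hassoc : star (uPath α) * (x * matrixUnit γ γ * y) * uPath β =
        star (uPath α) * x * uPath γ * (star (uPath γ) * y * uPath β) := by
      simp only [matrixUnit, mul_assoc]
    by_cases hγ : α.last = γ.last
    · rw [hassoc, hy (hγ ▸ h), mul_zero]
    · rw [hassoc, hx hγ, zero_mul]
  case smul =>
    intro t x hx α β h
    rw [mul_smul_comm, smul_mul_assoc, hx h, smul_zero]
  case star =>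
    intro x hx α β h
    have hstar := congrArg star (hx h.symm)
    simpa only [star_mul, star_star, star_zero, mul_assoc] using hstar
  case isClosed =>
    simp only [Set.ofPred_forall]
    exact isClosed_iInter fun _ => isClosed_iInter fun _ => isClosed_iInter fun _ =>
      isClosed_singleton_zero.preimage (continuous_mul_mul _ _)

end

/-! ### Corner ideals -/

section

variable {i j k m n p : ℕ} {W : WeightSequence G} {J : Submodule ℂ (LK G)}

theorem matrixUnit_mul_mul_matrixUnit_mem (hm : m + 1 = (n + 1) * p)
    (hJ : IsIdealOf (C W p n : Set (LK G)) J) {x : LK G} (hx : x ∈ J) {μ₁ μ₂ ν₁ ν₂ : G.Path m}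
    (h₁ : ν₁.src = μ₁.src) (h₂ : ν₂.src = μ₂.src) :
    matrixUnit ν₁ μ₁ * x * matrixUnit μ₂ ν₂ ∈ J := by
  have hle : n * p ≤ m := by
    cases p with
    | zero => omega
    | succ p => rw [Nat.succ_mul] at hm; omega
  have hlt : m < (n + 1) * p := by omega
  exact (hJ.2 _ (matrixUnit_mem_C hle hlt h₂.symm) _
    (hJ.2 _ (matrixUnit_mem_C hle hlt h₁) _ hx).1).2

theorem isIdempotentElem_matrixUnit (ζ : G.Path i) : IsIdempotentElem (matrixUnit ζ ζ) :=
  matrixUnit_mul_matrixUnit rfl ζ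

/-- The corner of `J` at a path `ζ`: the elements of the corner algebra of `u_ζ u_ζ^*` that land in
`J` when `ζ` is replaced by paths of length `m` with the same source. For the right `m` it is equal
to `u_ζ u_{μ₁}^* J u_{μ₂} u_ζ^*` for any such paths `μ₁, μ₂`; the definition avoids choosing
them. -/
def cornerIdeal (J : Submodule ℂ (LK G)) (m : ℕ) (ζ : G.Path i) : Submodule ℂ (LK G) where
  carrier := {c | c ∈ NonUnitalRing.corner (matrixUnit ζ ζ) ∧ ∀ μ₁ μ₂ : G.Path m,
    μ₁.src = ζ.src → μ₂.src = ζ.src → matrixUnit μ₁ ζ * c * matrixUnit ζ μ₂ ∈ J}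
  zero_mem' := ⟨zero_mem _, fun μ₁ μ₂ _ _ => by
    rw [mul_zero, zero_mul]
    exact zero_mem J⟩
  add_mem' := fun ⟨ha, ha'⟩ ⟨hb, hb'⟩ => ⟨add_mem ha hb, fun μ₁ μ₂ h₁ h₂ => by
    rw [mul_add, add_mul]
    exact add_mem (ha' μ₁ μ₂ h₁ h₂) (hb' μ₁ μ₂ h₁ h₂)⟩
  smul_mem' := by
    rintro t _ ⟨⟨a, rfl⟩, ha⟩
    refine ⟨⟨t • a, by simp only [mul_smul_comm, smul_mul_assoc]⟩, fun μ₁ μ₂ h₁ h₂ => ?_⟩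
    rw [mul_smul_comm, smul_mul_assoc]
    exact J.smul_mem t (ha μ₁ μ₂ h₁ h₂)

theorem matrixUnit_mul_mul_matrixUnit_of_mem_cornerIdeal {ζ : G.Path i} {c : LK G}
    (hc : c ∈ cornerIdeal J m ζ) : matrixUnit ζ ζ * c * matrixUnit ζ ζ = c := by
  obtain ⟨hleft, hright⟩ := (Subsemigroup.mem_corner_iff (isIdempotentElem_matrixUnit ζ)).1 hc.1
  rw [hleft, hright]

theorem matrixUnit_mul_mul_matrixUnit_mem_cornerIdeal_iff (hm : m + 1 = (n + 1) * p)
    (hJ : IsIdealOf (C W p n : Set (LK G)) J) {ζ : G.Path i} {ν₁ ν₂ : G.Path m}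
    (h₁ : ν₁.src = ζ.src) (h₂ : ν₂.src = ζ.src) (α : G.Path j) (β : G.Path k) (x : LK G) :
    matrixUnit ζ α * x * matrixUnit β ζ ∈ cornerIdeal J m ζ ↔
      matrixUnit ν₁ α * x * matrixUnit β ν₂ ∈ J := by
  constructor
  · intro h
    rw [← matrixUnit_sandwich h₁ h₂]
    exact h.2 ν₁ ν₂ h₁ h₂
  · intro h
    refine ⟨⟨_, matrixUnit_sandwich rfl rfl ..⟩, fun μ₁ μ₂ hμ₁ hμ₂ => ?_⟩
    have hν₁ : μ₁.src = ν₁.src := hμ₁.trans h₁.symm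
    have hν₂ : μ₂.src = ν₂.src := hμ₂.trans h₂.symm
    rw [matrixUnit_sandwich hμ₁ hμ₂, ← matrixUnit_sandwich hν₁ hν₂]
    exact matrixUnit_mul_mul_matrixUnit_mem hm hJ h hν₁ hν₂

theorem coe_cornerIdeal (hm : m + 1 = (n + 1) * p) (hJ : IsIdealOf (C W p n : Set (LK G)) J)
    {ζ : G.Path i} {μ₁ μ₂ : G.Path m} (h₁ : μ₁.src = ζ.src) (h₂ : μ₂.src = ζ.src) :
    (cornerIdeal J m ζ : Set (LK G)) =
      (fun x => matrixUnit ζ μ₁ * x * matrixUnit μ₂ ζ) '' (J : Set (LK G)) := by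
  ext c
  constructor
  · intro hc
    exact ⟨_, hc.2 μ₁ μ₂ h₁ h₂, by simp only [matrixUnit_sandwich h₁.symm h₂.symm,
      matrixUnit_mul_mul_matrixUnit_of_mem_cornerIdeal hc]⟩
  · rintro ⟨x, hx, rfl⟩
    exact (matrixUnit_mul_mul_matrixUnit_mem_cornerIdeal_iff hm hJ h₁ h₂ μ₁ μ₂ x).2
      (matrixUnit_mul_mul_matrixUnit_mem hm hJ hx rfl rfl)

theorem matrixUnit_mul_mul_mul_matrixUnit {ζ : G.Path i} {μ : G.Path m}
    (h : ζ.src = μ.src) (μ₁ : G.Path j) (μ₂ : G.Path k) {b : LK G} (hb : b * matrixUnit ζ ζ = b)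
    (c : LK G) : matrixUnit μ₁ ζ * (b * c) * matrixUnit ζ μ₂ =
      matrixUnit μ₁ ζ * b * matrixUnit ζ μ * (matrixUnit μ ζ * c * matrixUnit ζ μ₂) := by
  conv_lhs => rw [← hb, ← matrixUnit_mul_matrixUnit h ζ]
  simp only [mul_assoc]

theorem isIdealOf_cornerIdeal (hG : G.NoSinks) (hp : 1 ≤ p) (hm : m + 1 = (n + 1) * p)
    (hJ : IsIdealOf (C W p n : Set (LK G)) J) (ξ : V → G.Path (p - 1)) (v : V) :
    IsIdealOf (Cv W p ξ v) (cornerIdeal J m (ξ v)) := by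
  have hp' : p - 1 + 1 = (0 + 1) * p := by omega
  obtain ⟨μ, hμ⟩ := DirGraph.Path.exists_src_eq hG m (ξ v).src
  refine ⟨fun c hc => ?_, ?_⟩
  · have hexp := matrixUnit_mul_mul_matrixUnit_of_mem_cornerIdeal hc
    refine ⟨c, ?_, hexp.symm⟩
    rw [← hexp, ← matrixUnit_sandwich hμ.symm hμ.symm (ξ v) (ξ v) c]
    exact matrixUnit_mul_mul_matrixUnit_mem_C hG hm hp' (hJ.1 (hc.2 μ μ hμ hμ)) hμ.symm hμ.symm
  · rintro _ ⟨a, ha, rfl⟩ c ⟨hc, hcJ⟩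
    rw [← matrixUnit]
    set b := matrixUnit (ξ v) (ξ v) * a * matrixUnit (ξ v) (ξ v) with hb_def
    have hb : b ∈ NonUnitalRing.corner (matrixUnit (ξ v) (ξ v)) := ⟨a, rfl⟩
    have hbC {ν₁ ν₂ : G.Path m} (h₁ : ν₁.src = (ξ v).src) (h₂ : ν₂.src = (ξ v).src) :
        matrixUnit ν₁ (ξ v) * b * matrixUnit (ξ v) ν₂ ∈ C W p n := by
      rw [hb_def, matrixUnit_sandwich h₁ h₂]
      exact matrixUnit_mul_mul_matrixUnit_mem_C hG hp' hm ha h₁ h₂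
    have hright {x : LK G} (hx : x ∈ NonUnitalRing.corner (matrixUnit (ξ v) (ξ v))) :
        x * matrixUnit (ξ v) (ξ v) = x :=
      ((Subsemigroup.mem_corner_iff (isIdempotentElem_matrixUnit (ξ v))).1 hx).2
    refine ⟨⟨mul_mem hb hc, fun μ₁ μ₂ h₁ h₂ => ?_⟩, ⟨mul_mem hc hb, fun μ₁ μ₂ h₁ h₂ => ?_⟩⟩
    · rw [matrixUnit_mul_mul_mul_matrixUnit hμ.symm μ₁ μ₂ (hright hb)]
      exact (hJ.2 _ (hbC h₁ hμ) _ (hcJ μ μ₂ hμ h₂)).1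
    · rw [matrixUnit_mul_mul_mul_matrixUnit hμ.symm μ₁ μ₂ (hright hc)]
      exact (hJ.2 _ (hbC hμ h₂) _ (hcJ μ₁ μ h₁ hμ)).2

variable {ξ : V → G.Path (p - 1)}

theorem tau_sum_sum_matrixUnit_mul_mul_matrixUnit (hξ : ∀ v, (ξ v).src = v)
    {M : Matrix (G.Path (n * p + (p - 1))) (G.Path (n * p + (p - 1))) (LK G)}
    (hM : ∀ μ₁ μ₂, μ₁.src = μ₂.src →
      matrixUnit (ξ μ₁.src) (ξ μ₁.src) * M μ₁ μ₂ * matrixUnit (ξ μ₁.src) (ξ μ₁.src) = M μ₁ μ₂)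
    (hM₀ : ∀ μ₁ μ₂, μ₁.src ≠ μ₂.src → M μ₁ μ₂ = 0) :
    tau ξ n (∑ μ₁, ∑ μ₂, matrixUnit μ₁ (ξ μ₁.src) * M μ₁ μ₂ * matrixUnit (ξ μ₁.src) μ₂) = M := by
  ext ν₁ ν₂
  by_cases h : ν₁.src = ν₂.src
  swap
  · rw [tau_apply_of_src_ne ξ _ h, hM₀ ν₁ ν₂ h]
  rw [tau_apply_of_src_eq ξ _ h]
  simp only [Finset.mul_sum, Finset.sum_mul]
  rw [Finset.sum_eq_single ν₁, Finset.sum_eq_single ν₂, matrixUnit_sandwich (hξ _)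
    ((hξ _).trans h), hM ν₁ ν₂ h]
  · intro μ₂ _ hμ
    rw [mul_assoc, mul_assoc _ _ (matrixUnit ν₂ _), matrixUnit_mul_matrixUnit_of_ne _ hμ,
      mul_zero, mul_zero]
  · simp
  · intro μ₁ _ hμ
    simp only [← mul_assoc, matrixUnit_mul_matrixUnit_of_ne _ hμ.symm, zero_mul,
      Finset.sum_const_zero]
  · simp

theorem tau_image_eq (hp : 1 ≤ p) (hJ : IsIdealOf (C W p n : Set (LK G)) J)
    (hξ : ∀ v, (ξ v).src = v) :
    tau ξ n '' (J : Set (LK G)) = {M | ∀ μ₁ μ₂ : G.Path (n * p + (p - 1)),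
      (μ₁.src = μ₂.src → M μ₁ μ₂ ∈ cornerIdeal J (n * p + (p - 1)) (ξ μ₁.src)) ∧
        (μ₁.src ≠ μ₂.src → M μ₁ μ₂ = 0)} := by
  have hm : n * p + (p - 1) + 1 = (n + 1) * p := by rw [Nat.succ_mul]; omega
  ext M
  constructor
  · rintro ⟨x, hx, rfl⟩ μ₁ μ₂
    refine ⟨fun h => ?_, tau_apply_of_src_ne ξ x⟩
    rw [tau_apply_of_src_eq ξ x h, ← SetLike.mem_coe,
      coe_cornerIdeal hm hJ (hξ μ₁.src).symm (h.symm.trans (hξ μ₁.src).symm)]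
    exact ⟨x, hx, rfl⟩
  · intro hM
    refine ⟨_, sum_mem fun μ₁ _ => sum_mem fun μ₂ _ => ?_,
      tau_sum_sum_matrixUnit_mul_mul_matrixUnit hξ
        (fun μ₁ μ₂ h => matrixUnit_mul_mul_matrixUnit_of_mem_cornerIdeal ((hM μ₁ μ₂).1 h))
        fun μ₁ μ₂ => (hM μ₁ μ₂).2⟩
    by_cases h : μ₁.src = μ₂.src
    · exact ((hM μ₁ μ₂).1 h).2 μ₁ μ₂ (hξ _).symm (h.symm.trans (hξ _).symm)
    · rw [(hM μ₁ μ₂).2 h, mul_zero, zero_mul]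
      exact J.zero_mem

theorem isCornerFamily_cornerIdeal (hG : G.NoSinks) (hp : 1 ≤ p)
    (hJ : IsIdealOf (C W p n : Set (LK G)) J) (hξ : ∀ v, (ξ v).src = v) :
    IsCornerFamily W p n ξ J fun v => cornerIdeal J (n * p + (p - 1)) (ξ v) := by
  have hm : n * p + (p - 1) + 1 = (n + 1) * p := by rw [Nat.succ_mul]; omega
  refine ⟨isIdealOf_cornerIdeal hG hp hm hJ ξ, tau_image_eq hp hJ hξ, fun v μ₁ μ₂ h₁ h₂ => ?_⟩
  rw [coe_cornerIdeal hm hJ (h₁.trans (hξ v).symm) (h₂.trans (hξ v).symm)]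
  simp only [matrixUnit, mul_assoc]

theorem IsCornerFamily.eq_cornerIdeal (hG : G.NoSinks) (hp : 1 ≤ p)
    (hJ : IsIdealOf (C W p n : Set (LK G)) J) (hξ : ∀ v, (ξ v).src = v)
    {Jv : V → Submodule ℂ (LK G)} (h : IsCornerFamily W p n ξ J Jv) :
    Jv = fun v => cornerIdeal J (n * p + (p - 1)) (ξ v) := by
  funext v
  obtain ⟨μ, hμ⟩ := DirGraph.Path.exists_src_eq hG (n * p + (p - 1)) v
  exact SetLike.coe_injective ((h.corner v μ μ hμ hμ).trans
    ((isCornerFamily_cornerIdeal hG hp hJ hξ).corner v μ μ hμ hμ).symm)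

theorem existsUnique_isCornerFamily (hG : G.NoSinks) (hp : 1 ≤ p)
    (hJ : IsIdealOf (C W p n : Set (LK G)) J) (hξ : ∀ v, (ξ v).src = v) :
    ∃! Jv : V → Submodule ℂ (LK G), IsCornerFamily W p n ξ J Jv :=
  ⟨_, isCornerFamily_cornerIdeal hG hp hJ hξ, fun _ h => h.eq_cornerIdeal hG hp hJ hξ⟩

end

/-! ### Invariance -/

section

variable {m n p : ℕ} {W : WeightSequence G} {J : Submodule ℂ (LK G)} {ξ : V → G.Path (p - 1)}

theorem matrixUnit_self_mul_star_u_of_eq {e : E} {γ : G.Path m} (h : G.s e = γ.rng) :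
    matrixUnit γ γ * star (u G e) = matrixUnit γ (γ.cons e h) := by
  rw [matrixUnit, matrixUnit, uPath_cons, star_mul, mul_assoc]

theorem matrixUnit_self_mul_star_u_of_ne {e : E} {γ : G.Path m} (h : G.s e ≠ γ.rng) :
    matrixUnit γ γ * star (u G e) = 0 := by
  rw [matrixUnit, mul_assoc, ← star_mul, u_mul_uPath_of_ne h, star_zero, mul_zero]

theorem isInvariant_iff (hm : m + 1 = (n + 1) * p) (hJ : IsIdealOf (C W p n : Set (LK G)) J) :
    IsInvariant J ↔ ∀ α β : G.Path (m + 1), ∀ x ∈ J,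
      matrixUnit α.tail α * x * matrixUnit β β.tail ∈ J := by
  have hleft (α : G.Path (m + 1)) :
      matrixUnit α.tail α = matrixUnit α.tail α.tail * star (u G α.head) := by
    rw [matrixUnit, matrixUnit, uPath_eq_u_head_mul_uPath_tail α, star_mul, mul_assoc]
  constructor
  · intro hinv α β x hx
    have hright : matrixUnit β β.tail = u G β.head * matrixUnit β.tail β.tail := by
      rw [← star_matrixUnit, hleft, star_mul, star_star, star_matrixUnit]
    have hassoc : matrixUnit α.tail α * x * matrixUnit β β.tail =
        matrixUnit α.tail α.tail * (star (u G α.head) * x * u G β.head) *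
          matrixUnit β.tail β.tail := by
      rw [hleft, hright]
      simp only [mul_assoc]
    rw [hassoc]
    exact matrixUnit_mul_mul_matrixUnit_mem hm hJ (hinv _ _ x hx) rfl rfl
  · intro h e f x hx
    rw [eq_sum_matrixUnit_mul_mul m (star (u G e) * x * u G f)]
    refine sum_mem fun γ _ => sum_mem fun δ _ => ?_
    have hassoc : matrixUnit γ γ * (star (u G e) * x * u G f) * matrixUnit δ δ =
        matrixUnit γ γ * star (u G e) * x * star (matrixUnit δ δ * star (u G f)) := by
      simp only [star_mul, star_star, star_matrixUnit, mul_assoc]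
    rw [hassoc]
    by_cases hγ : G.s e = γ.rng
    swap
    · rw [matrixUnit_self_mul_star_u_of_ne hγ, zero_mul, zero_mul]
      exact J.zero_mem
    by_cases hδ : G.s f = δ.rng
    swap
    · rw [matrixUnit_self_mul_star_u_of_ne hδ, star_zero, mul_zero]
      exact J.zero_mem
    have hmem := h (γ.cons e hγ) (δ.cons f hδ) x hx
    rw [γ.tail_cons, δ.tail_cons] at hmem
    rwa [matrixUnit_self_mul_star_u_of_eq hγ, matrixUnit_self_mul_star_u_of_eq hδ, star_matrixUnit]

theorem piMap_matrixUnit_mul_mul_matrixUnit (hξ : ∀ v, (ξ v).src = v) {e f : E} {μ ν : G.Path m}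
    (hμ : μ.src = G.r e) (hν : ν.src = G.r f) (x : LK G) :
    piMap ξ e f (matrixUnit (ξ (G.r e)) μ * x * matrixUnit ν (ξ (G.r f))) =
      matrixUnit (ξ (G.s e)) (μ.snoc e hμ) * x * matrixUnit (ν.snoc f hν) (ξ (G.s f)) := by
  have hleft : star (uPath (ξ (G.r e))) * matrixUnit (ξ (G.r e)) μ = star (uPath μ) := by
    rw [← star_matrixUnit, ← star_mul, matrixUnit_mul_uPath (hμ.trans (hξ _).symm)]
  have hright : matrixUnit ν (ξ (G.r f)) * uPath (ξ (G.r f)) = uPath ν :=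
    matrixUnit_mul_uPath (hν.trans (hξ _).symm)
  calc piMap ξ e f (matrixUnit (ξ (G.r e)) μ * x * matrixUnit ν (ξ (G.r f)))
      = uPath (ξ (G.s e)) * star (u G e) * (star (uPath (ξ (G.r e))) * matrixUnit (ξ (G.r e)) μ) *
          x * (matrixUnit ν (ξ (G.r f)) * uPath (ξ (G.r f))) * u G f *
            star (uPath (ξ (G.s f))) := by
        simp only [piMap, mul_assoc]
    _ = matrixUnit (ξ (G.s e)) (μ.snoc e hμ) * x * matrixUnit (ν.snoc f hν) (ξ (G.s f)) := by
        rw [hleft, hright]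
        simp only [matrixUnit, uPath_snoc, star_mul, mul_assoc]

theorem IsInvariant.piMap_mem_cornerIdeal (hinv : IsInvariant J) (hG : G.NoSinks)
    (hm : m + 1 = (n + 1) * p) (hJ : IsIdealOf (C W p n : Set (LK G)) J)
    (hξ : ∀ v, (ξ v).src = v) {e f : E} (hr : G.r e = G.r f) (hs : G.s e = G.s f) {c : LK G}
    (hc : c ∈ cornerIdeal J m (ξ (G.r e))) : piMap ξ e f c ∈ cornerIdeal J m (ξ (G.s e)) := by
  obtain ⟨μ, hμ⟩ := DirGraph.Path.exists_src_eq hG m (G.r e)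
  have hμ' : μ.src = (ξ (G.r e)).src := hμ.trans (hξ _).symm
  rw [← SetLike.mem_coe, coe_cornerIdeal hm hJ hμ' hμ'] at hc
  obtain ⟨x, hx, rfl⟩ := hc
  have hpi := piMap_matrixUnit_mul_mul_matrixUnit hξ hμ (hμ.trans hr) x
  rw [← congrArg ξ hr, ← congrArg ξ hs] at hpi
  rw [hpi, matrixUnit_mul_mul_matrixUnit_mem_cornerIdeal_iff hm hJ
    (ν₁ := (μ.snoc e hμ).tail) (ν₂ := (μ.snoc f (hμ.trans hr)).tail)]
  · exact (isInvariant_iff hm hJ).1 hinv _ _ x hx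
  · rw [DirGraph.Path.src_tail, μ.src_snoc, hξ]
  · rw [DirGraph.Path.src_tail, μ.src_snoc, hξ, hs]

theorem isInvariant_of_piMap_mem_cornerIdeal (hA : ConditionA W p) (hm : m + 1 = (n + 1) * p)
    (hJ : IsIdealOf (C W p n : Set (LK G)) J) (hξ : ∀ v, (ξ v).src = v)
    (hpi : ∀ e : E, ∀ c ∈ cornerIdeal J m (ξ (G.r e)),
      piMap ξ e e c ∈ cornerIdeal J m (ξ (G.s e))) : IsInvariant J := by
  refine (isInvariant_iff hm hJ).2 fun α β x hx => ?_
  by_cases hlast : α.last = β.last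
  · obtain ⟨μ, e, hμ, rfl⟩ := α.exists_eq_snoc
    obtain ⟨ν, f, hν, rfl⟩ := β.exists_eq_snoc
    obtain rfl : e = f := by simpa only [DirGraph.Path.last_snoc] using hlast
    have hc : matrixUnit (ξ (G.r e)) μ * x * matrixUnit ν (ξ (G.r e)) ∈
        cornerIdeal J m (ξ (G.r e)) :=
      (matrixUnit_mul_mul_matrixUnit_mem_cornerIdeal_iff hm hJ (hμ.trans (hξ _).symm)
        (hν.trans (hξ _).symm) μ ν x).2 (matrixUnit_mul_mul_matrixUnit_mem hm hJ hx rfl rfl)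
    have hmem := hpi e _ hc
    rw [piMap_matrixUnit_mul_mul_matrixUnit hξ hμ hν] at hmem
    refine (matrixUnit_mul_mul_matrixUnit_mem_cornerIdeal_iff hm hJ ?_ ?_ _ _ x).1 hmem <;>
      rw [DirGraph.Path.src_tail, DirGraph.Path.src_snoc, hξ]
  · have hassoc : matrixUnit α.tail α * x * matrixUnit β β.tail =
        uPath α.tail * (star (uPath α) * x * uPath β) * star (uPath β.tail) := by
      simp only [matrixUnit, mul_assoc]
    rw [hassoc, star_uPath_mul_mul_uPath_of_last_ne hA hm (hJ.1 hx) hlast, mul_zero, zero_mul]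
    exact J.zero_mem

end

end WeightedCK

end

open WeightedCK in
theorem mainTheorem11_general {V E : Type*} [Fintype V] [Fintype E] (G : DirGraph V E)
    (hsinks : G.NoSinks) (W : WeightSequence G) (p : ℕ) (hp : 1 ≤ p) (hA : ConditionA W p)
    (ξ : V → G.Path (p - 1)) (hξ : ∀ v, (ξ v).src = v)
    (n : ℕ) (J : Submodule ℂ (LK G)) (hJ : IsIdealOf (C W p n : Set (LK G)) J) :
    (∃! Jv : V → Submodule ℂ (LK G), IsCornerFamily W p n ξ J Jv) ∧
    ∀ Jv : V → Submodule ℂ (LK G), IsCornerFamily W p n ξ J Jv →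
      (IsInvariant J ↔
        ∀ e f : E, G.r e = G.r f → G.s e = G.s f →
          ∀ c ∈ Jv (G.r e), piMap ξ e f c ∈ Jv (G.s e)) := by
  have hm : n * p + (p - 1) + 1 = (n + 1) * p := by rw [Nat.succ_mul]; omega
  refine ⟨existsUnique_isCornerFamily hsinks hp hJ hξ, fun Jv h => ?_⟩
  obtain rfl := h.eq_cornerIdeal hsinks hp hJ hξ
  constructor
  · exact fun hinv e f hr hs c hc => hinv.piMap_mem_cornerIdeal hsinks hm hJ hξ hr hs hc
  · exact fun hpi => isInvariant_of_piMap_mem_cornerIdeal hA hm hJ hξ fun e => hpi e e rfl rfl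

open WeightedCK in
theorem mainTheorem11 {V E : Type*} [Fintype V] [Fintype E] (G : DirGraph V E)
    (hsinks : G.NoSinks) (hsources : G.NoSources)
    (W : WeightSequence G) (p : ℕ) (hp : 1 ≤ p) (hA : ConditionA W p)
    (ξ : V → G.Path (p - 1)) (hξ : ∀ v, (ξ v).src = v)
    (n : ℕ) (J : Submodule ℂ (LK G)) (hJ : IsIdealOf (C W p n : Set (LK G)) J) :
    (∃! Jv : V → Submodule ℂ (LK G), IsCornerFamily W p n ξ J Jv) ∧
    ∀ Jv : V → Submodule ℂ (LK G), IsCornerFamily W p n ξ J Jv →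
      (IsInvariant J ↔
        ∀ e f : E, G.r e = G.r f → G.s e = G.s f →
          ∀ c ∈ Jv (G.r e), piMap ξ e f c ∈ Jv (G.s e)) :=
  mainTheorem11_general G hsinks W p hp hA ξ hξ n J hJ
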